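/- Let $R$ be a commutative artinian ring and let $\mathcal C$ be an $R$-variety, that is, a small additive $R$-linear category in which idempotents split. For a small preadditive category $\mathcal A$, let $\mathrm{Mod}(\mathcal A)$ be the category of additive functors $\mathcal A\to\mathbf{Ab}$, and let $\mathrm{mod}(\mathcal A)$ be its full subcategory of finitely presented functors, i.e. of those $M$ for which there is an exact sequence $\mathrm{Hom}_{\mathcal A}(A_0,-)\to\mathrm{Hom}_{\mathcal A}(A_1,-)\to M\to 0$ with $A_0,A_1\in\mathcal A$. Assume that $\mathcal C$ is dualizing: all $\mathrm{Hom}_{\mathcal C}(X,Y)$ are finitely generated $R$-modules, and $M\mapsto \mathrm{Hom}_R(M(-),E)$, with $E$ the injective envelope of $R/\mathrm{rad}(R)$, induces a duality between $\mathrm{mod}(\mathcal C)$ and $\mathrm{mod}(\mathcal C^{op})$. Let $\mathcal I$ be a two-sided ideal of $\mathcal C$ with property $A$: for each $C\in\mathcal C$ there are objects $X,Y\in\mathcal C$ and epimorphisms $\mathrm{Hom}_{\mathcal C}(X,-)\to\mathcal I(C,-)$ in $\mathrm{Mod}(\mathcal C)$ and $\mathrm{Hom}_{\mathcal C}(-,Y)\to\mathcal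 I(-,C)$ in $\mathrm{Mod}(\mathcal C^{op})$. Let $\pi:\mathcal C\to\mathcal C/\mathcal I$ be the quotient functor; composition with $\pi$ gives an exact functor $\pi_*:\mathrm{Mod}(\mathcal C/\mathcal I)\to\mathrm{Mod}(\mathcal C)$, $F\mapsto F\circ\pi$, which restricts to an exact functor $\mathrm{mod}(\mathcal C/\mathcal I)\to\mathrm{mod}(\mathcal C)$ between abelian categories; composition with $\pi^{op}$ gives likewise $\mathrm{Mod}((\mathcal C/\mathcal I)^{op})\to\mathrm{Mod}(\mathcal C^{op})$, also written $F\mapsto F\circ\pi$. Let $\mathbb{EXT}^i_{\mathcal C}(\mathcal C/\mathcal I,-):\mathrm{Mod}(\mathcal C)\to\mathrm{Mod}(\mathcal C/\mathcal I)$ be the $i$-th right derived functor of $M\mapsto\big(C\mapsto \mathrm{Hom}_{\mathrm{Mod}(\mathcal C)}(\mathcal C(C,-)/\mathcal I(C,-),M)\big)$, and let $\mathbb{TOR}_i^{\mathcal C}(\mathcal C/\mathcal I,-):\mathrm{Mod}(\mathcal C)\to\mathrm{Mod}(\mathcal C/\mathcal I)$ be the $i$-th left derived functor of $M\mapsto\big(C\mapsto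 (\mathcal C(-,C)/\mathcal I(-,C))\otimes_{\mathcal C}M\big)$. Let $\mathrm{Tor}_i^{\mathcal C}(N,-)$ be the $i$-th left derived functor of $N\otimes_{\mathcal C}-:\mathrm{Mod}(\mathcal C)\to\mathbf{Ab}$, and similarly for $\mathcal C/\mathcal I$. Let $\varphi^i$ denote the homomorphisms on $\mathrm{Ext}^i$ induced by the exact functor $\pi_*$. For $F\in\mathrm{Mod}((\mathcal C/\mathcal I)^{op})$ and $F'\in\mathrm{Mod}(\mathcal C/\mathcal I)$, let $$\psi^i_{F,F'}:\mathrm{Tor}_i^{\mathcal C}(F\circ\pi,F'\circ\pi)\to\mathrm{Tor}_i^{\mathcal C/\mathcal I}(F,F')$$ be the canonical homomorphism induced by $(F\circ\pi)\otimes_{\mathcal C}P\to(F\circ\pi)\otimes_{\mathcal C}(Q\circ\pi)\to F\otimes_{\mathcal C/\mathcal I}Q$, where $P\to F'\circ\pi$ and $Q\to F'$ are projective resolutions in $\mathrm{Mod}(\mathcal C)$ and $\mathrm{Mod}(\mathcal C/\mathcal I)$, the first map comes from a chain map $P\to Q\circ\pi$ lifting the identity of $F'\circ\pi$, and the second is $x\otimes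 y\mapsto x\otimes y$. Let $k\ge 0$ be an integer. Then the following are equivalent. (a) $\mathcal I$ is $k$-idempotent, i.e. $\varphi^i:\mathrm{Ext}^i_{\mathrm{Mod}(\mathcal C/\mathcal I)}(F,F')\to\mathrm{Ext}^i_{\mathrm{Mod}(\mathcal C)}(F\circ\pi,F'\circ\pi)$ is an isomorphism for all $F,F'\in\mathrm{Mod}(\mathcal C/\mathcal I)$ and all $0\le i\le k$. (b) $\varphi^i:\mathrm{Ext}^i_{\mathrm{mod}(\mathcal C/\mathcal I)}(F,F')\to\mathrm{Ext}^i_{\mathrm{mod}(\mathcal C)}(F\circ\pi,F'\circ\pi)$ is an isomorphism for all $F,F'\in\mathrm{mod}(\mathcal C/\mathcal I)$ and all $0\le i\le k$. (c) $\mathbb{EXT}^i_{\mathcal C}(\mathcal C/\mathcal I,F'\circ\pi)=0$ for all $1\le i\le k$ and all $F'\in\mathrm{mod}(\mathcal C/\mathcal I)$. (d) $\mathbb{EXT}^i_{\mathcal C}(\mathcal C/\mathcal I,J\circ\pi)=0$ for all $1\le i\le k$ and all injective objects $J$ of $\mathrm{mod}(\mathcal C/\mathcal I)$. (e) $\psi^i_{F,F'}$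 is an isomorphism for all $1\le i\le k$, all $F\in\mathrm{mod}((\mathcal C/\mathcal I)^{op})$ and all $F'\in\mathrm{mod}(\mathcal C/\mathcal I)$. (f) $\mathbb{TOR}_i^{\mathcal C}(\mathcal C/\mathcal I,F'\circ\pi)=0$ for all $1\le i\le k$ and all $F'\in\mathrm{mod}(\mathcal C/\mathcal I)$. (g) $\mathbb{TOR}_i^{\mathcal C}(\mathcal C/\mathcal I,\mathrm{Hom}_{\mathcal C/\mathcal I}(C,-)\circ\pi)=0$ for all $1\le i\le k$ and all $C\in\mathcal C/\mathcal I$. -/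

import Mathlib

open CategoryTheory CategoryTheory.Limits Opposite

universe u

open scoped ZeroObject

namespace KIdem

noncomputable section

section Modules

variable (C : Type u) [Category.{u} C] [Preadditive C]

/-- `Mod(C)`: additive (covariant) functors from `C` to abelian groups. -/
abbrev CMod : Type (u + 1) := C ⥤+ AddCommGrpCat.{u}

instance : (additiveFunctor C AddCommGrpCat.{u}).ContainsZero where
  exists_zero := ⟨_, isZero_zero _, .of_isZero (isZero_zero _)⟩

instance (J : Type u) [Category.{u} J] :
    (additiveFunctor C AddCommGrpCat.{u}).IsClosedUnderLimitsOfShape J where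
  limitsOfShape_le := by
    rintro X ⟨p⟩
    refine ⟨fun {A B f g} => ?_⟩
    refine (isLimitOfPreserves ((evaluation C AddCommGrpCat.{u}).obj B) p.isLimit).hom_ext
      fun j => ?_
    have h : (p.diag.obj j).Additive := p.prop_diag_obj j
    have e := fun k : A ⟶ B => (p.π.app j).naturality k
    dsimp at e ⊢
    rw [e, Preadditive.add_comp, e, e, h.map_add, Preadditive.comp_add]

instance (J : Type u) [Category.{u} J] :
    (additiveFunctor C AddCommGrpCat.{u}).IsClosedUnderColimitsOfShape J where
  colimitsOfShape_le := by
    rintro X ⟨p⟩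
    refine ⟨fun {A B f g} => ?_⟩
    refine (isColimitOfPreserves ((evaluation C AddCommGrpCat.{u}).obj A) p.isColimit).hom_ext
      fun j => ?_
    have h : (p.diag.obj j).Additive := p.prop_diag_obj j
    have e := fun k : A ⟶ B => (p.ι.app j).naturality k
    dsimp at e ⊢
    rw [← e, Preadditive.comp_add, ← e, ← e, h.map_add, Preadditive.add_comp]

instance : (additiveFunctor C AddCommGrpCat.{u}).IsClosedUnderSubobjects where
  prop_of_mono {X Y} f _ h := by
    have h : Y.Additive := h
    refine ⟨fun {A B a b} => ?_⟩
    have : Mono (f.app B) := inferInstance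
    rw [← cancel_mono (f.app B), f.naturality, Preadditive.add_comp, f.naturality, f.naturality,
      h.map_add, Preadditive.comp_add]

instance : (additiveFunctor C AddCommGrpCat.{u}).IsClosedUnderQuotients where
  prop_of_epi {X Y} f _ h := by
    have h : X.Additive := h
    refine ⟨fun {A B a b} => ?_⟩
    have : Epi (f.app A) := inferInstance
    rw [← cancel_epi (f.app A), ← f.naturality, Preadditive.comp_add, ← f.naturality,
      ← f.naturality, h.map_add, Preadditive.add_comp]

instance : (additiveFunctor C AddCommGrpCat.{u}).IsClosedUnderFiniteProducts :=
  .of_isClosedUnderLimitsOfShape.{u} fun _ _ => inferInstance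


instance : PreservesFiniteLimits (AdditiveFunctor.forget C AddCommGrpCat.{u}) :=
  have := (additiveFunctor C AddCommGrpCat.{u}).preservesKernels_ι
  Functor.preservesFiniteLimits_of_preservesKernels _

instance : PreservesFiniteColimits (AdditiveFunctor.forget C AddCommGrpCat.{u}) :=
  have := (additiveFunctor C AddCommGrpCat.{u}).preservesCokernels_ι
  Functor.preservesFiniteColimits_of_preservesCokernels _

variable {C}

/-- The representable module `Hom(X, -)`. -/
def rep (X : C) : CMod C := ⟨preadditiveCoyoneda.obj (op X), additive_coyonedaObj' _⟩

/-- Yoneda: the morphism `Hom(X, -) ⟶ M` with `𝟙 X ↦ m`. -/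
def repHom {X : C} {M : CMod C} (m : M.obj.obj X) : rep X ⟶ M :=
  ObjectProperty.homMk
    { app := fun Y => AddCommGrpCat.ofHom
        (AddMonoidHom.mk' (fun f : X ⟶ Y => M.obj.map f m) (fun f g =>
          ConcreteCategory.congr_hom (M.obj.map_add (f := (f : X ⟶ Y)) (g := g)) m))
      naturality := fun Y Z g => by
        ext f
        exact ConcreteCategory.congr_hom (M.obj.map_comp f g) m }

@[simp]
lemma repHom_app {X Y : C} {M : CMod C} (m : M.obj.obj X) (f : X ⟶ Y) :
    (repHom m).hom.app Y (f : (rep X).obj.obj Y) = M.obj.map f m := rfl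

lemma hom_app_map {M N : CMod C} (φ : M ⟶ N) {X Y : C} (f : X ⟶ Y) (m : M.obj.obj X) :
    φ.hom.app Y (M.obj.map f m) = N.obj.map f (φ.hom.app X m) :=
  ConcreteCategory.congr_hom (φ.hom.naturality f) m

lemma rep_hom_ext {X : C} {M : CMod C} {φ ψ : rep X ⟶ M}
    (h : φ.hom.app X (𝟙 X : X ⟶ X) = ψ.hom.app X (𝟙 X : X ⟶ X)) : φ = ψ := by
  ext Y f
  have e (χ : rep X ⟶ M) : χ.hom.app Y f = M.obj.map (f : X ⟶ Y) (χ.hom.app X (𝟙 X : X ⟶ X)) :=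
    (congrArg (χ.hom.app Y) (Category.id_comp (f : X ⟶ Y)).symm).trans
      (hom_app_map χ (f : X ⟶ Y) (𝟙 X : X ⟶ X))
  exact (e φ).trans ((congrArg _ h).trans (e ψ).symm)

lemma epi_iff {M N : CMod C} (φ : M ⟶ N) :
    Epi φ ↔ ∀ X, Function.Surjective (φ.hom.app X) := by
  have : Epi φ ↔ Epi ((AdditiveFunctor.forget C AddCommGrpCat.{u}).map φ) :=
    ((AdditiveFunctor.forget C AddCommGrpCat.{u}).epi_map_iff_epi φ).symm
  rw [this, NatTrans.epi_iff_epi_app]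
  exact forall_congr' fun X => AddCommGrpCat.epi_iff_surjective _

lemma mono_iff {M N : CMod C} (φ : M ⟶ N) :
    Mono φ ↔ ∀ X, Function.Injective (φ.hom.app X) := by
  have : Mono φ ↔ Mono ((AdditiveFunctor.forget C AddCommGrpCat.{u}).map φ) :=
    ((AdditiveFunctor.forget C AddCommGrpCat.{u}).mono_map_iff_mono φ).symm
  rw [this, NatTrans.mono_iff_mono_app]
  exact forall_congr' fun X => AddCommGrpCat.mono_iff_injective _

lemma exact_iff (S : ShortComplex (CMod C)) :
    S.Exact ↔ ∀ X, Function.Exact (S.f.hom.app X) (S.g.hom.app X) := by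
  rw [← S.exact_map_iff_of_faithful (AdditiveFunctor.forget C AddCommGrpCat.{u})]
  have key : (S.map (AdditiveFunctor.forget C AddCommGrpCat.{u})).Exact ↔
      ∀ X, ((S.map (AdditiveFunctor.forget C AddCommGrpCat.{u})).map
        ((evaluation C AddCommGrpCat.{u}).obj X)).Exact := by
    refine ⟨fun h X => h.map _, fun h => ?_⟩
    rw [ShortComplex.exact_iff_isZero_homology, Functor.isZero_iff]
    intro X
    exact ((ShortComplex.exact_iff_isZero_homology _).1 (h X)).of_iso
      (ShortComplex.mapHomologyIso _ ((evaluation C AddCommGrpCat.{u}).obj X)).symm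
  rw [key]
  exact forall_congr' fun X => ShortComplex.ab_exact_iff_function_exact _

instance projective_rep (X : C) : Projective (rep X) where
  factors {E M} f e he := by
    obtain ⟨m, hm⟩ := (epi_iff e).1 he X (f.hom.app X (𝟙 X : X ⟶ X))
    refine ⟨repHom m, rep_hom_ext ?_⟩
    change e.hom.app X (E.obj.map (𝟙 X) m) = _
    rw [E.obj.map_id]
    exact hm

instance : EnoughProjectives (CMod C) where
  presentation M := ⟨
    { p := ∐ fun i : Σ X : C, M.obj.obj X => rep i.1
      projective := inferInstance
      f := Sigma.desc fun i => repHom i.2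
      epi := by
        rw [epi_iff]
        intro X m
        refine ⟨(Sigma.ι (fun i : Σ X : C, M.obj.obj X => rep i.1) ⟨X, m⟩).hom.app X
          (𝟙 X : X ⟶ X), ?_⟩
        have h := Sigma.ι_desc (fun i : Σ X : C, M.obj.obj X => repHom i.2) ⟨X, m⟩
        have h2 := congrArg (fun φ => φ.hom.app X (𝟙 X : X ⟶ X)) h
        refine Eq.trans h2 ?_
        change M.obj.map (𝟙 X) m = m
        rw [M.obj.map_id]; rfl }⟩

/-- The cofree module `Y ↦ Hom_ℤ(Hom(Y, X), A)`. -/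
def cofree (X : C) (A : AddCommGrpCat.{u}) : CMod C where
  obj :=
    { obj := fun Y => AddCommGrpCat.of ((Y ⟶ X) →+ A)
      map := fun {Y Z} f => AddCommGrpCat.ofHom
        (AddMonoidHom.mk' (fun φ => φ.comp (Preadditive.leftComp X f)) (fun _ _ => rfl))
      map_id := fun Y => by
        ext φ g
        exact congrArg (show (Y ⟶ X) →+ A from φ) (Category.id_comp g)
      map_comp := fun {Y Z W} f g => by
        ext φ h
        exact congrArg (show (Y ⟶ X) →+ A from φ) (Category.assoc f g h) }
  property := ⟨fun {Y Z f g} => by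
    ext φ h
    exact (congrArg (show (Y ⟶ X) →+ A from φ) (Preadditive.add_comp _ _ _ f g h)).trans
      (map_add (show (Y ⟶ X) →+ A from φ) _ _)⟩

/-- The morphism to a cofree module given by a morphism `M X ⟶ A`. -/
def cofreeLift {X : C} {A : AddCommGrpCat.{u}} {M : CMod C} (φ : M.obj.obj X ⟶ A) :
    M ⟶ cofree X A :=
  ObjectProperty.homMk
    { app := fun Y => AddCommGrpCat.ofHom
        (AddMonoidHom.mk' (fun m => AddMonoidHom.mk' (fun f : Y ⟶ X => φ (M.obj.map f m))
          (fun f g => by simp [M.obj.map_add]))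
          (fun a b => by apply AddMonoidHom.ext; intro f; simp))
      naturality := fun Y Z f => by
        ext m
        refine AddMonoidHom.ext fun (g : Z ⟶ X) => ?_
        exact congrArg φ (ConcreteCategory.congr_hom (M.obj.map_comp f g) m).symm }

/-- Evaluation at the identity. -/
def cofreeEval (X : C) (A : AddCommGrpCat.{u}) : (cofree X A).obj.obj X ⟶ A :=
  AddCommGrpCat.ofHom (AddMonoidHom.eval (𝟙 X : X ⟶ X))

lemma cofreeLift_eval {X : C} {A : AddCommGrpCat.{u}} {M : CMod C} (g : M ⟶ cofree X A) :
    cofreeLift (g.hom.app X ≫ cofreeEval X A) = g := by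
  ext Y m
  refine AddMonoidHom.ext fun (f : Y ⟶ X) => ?_
  have h := congrArg (cofreeEval X A) (hom_app_map g f m)
  refine h.trans ?_
  exact congrArg (show (Y ⟶ X) →+ A from g.hom.app Y m) (Category.comp_id f)

instance (X : C) (A : AddCommGrpCat.{u}) [Injective A] : Injective (cofree X A) where
  factors {M N} g f hf := by
    have : Mono (f.hom.app X) := (AddCommGrpCat.mono_iff_injective _).2 ((mono_iff f).1 hf X)
    refine ⟨cofreeLift (Injective.factorThru (g.hom.app X ≫ cofreeEval X A) (f.hom.app X)), ?_⟩
    have e := cofreeLift_eval g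
    rw [← Injective.comp_factorThru (g.hom.app X ≫ cofreeEval X A) (f.hom.app X)] at e
    refine Eq.trans ?_ e
    ext Y m
    refine AddMonoidHom.ext fun (h : Y ⟶ X) => ?_
    exact congrArg (Injective.factorThru (g.hom.app X ≫ cofreeEval X A) (f.hom.app X))
      (hom_app_map f h m).symm

instance : EnoughInjectives (CMod C) where
  presentation M := ⟨
    { J := ∏ᶜ fun X : C => cofree X (Injective.under (M.obj.obj X))
      injective := inferInstance
      f := Pi.lift fun X => cofreeLift (Injective.ι _)
      mono := by
        rw [mono_iff]
        intro X m n h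
        have e (a : M.obj.obj X) := congrArg (fun φ => φ.hom.app X a)
          (Pi.lift_π (fun X : C => cofreeLift (Injective.ι (M.obj.obj X))) X)
        have h2 := (e m).symm.trans ((congrArg ((Pi.π (fun X : C =>
          cofree X (Injective.under (M.obj.obj X))) X).hom.app X) h).trans (e n))
        have h3 := congrArg (cofreeEval X _) h2
        change Injective.ι (M.obj.obj X) (M.obj.map (𝟙 X) m) =
          Injective.ι (M.obj.obj X) (M.obj.map (𝟙 X) n) at h3
        rw [M.obj.map_id] at h3
        exact (AddCommGrpCat.mono_iff_injective _).1 inferInstance h3 }⟩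

instance : HasExt.{u} (CMod C) := hasExt_of_enoughProjectives _


end Modules

section FinitelyPresented

variable (C : Type u) [Category.{u} C] [Preadditive C]

/-- `M` is finitely presented: there is an exact sequence
`Hom(X₀, -) ⟶ Hom(X₁, -) ⟶ M ⟶ 0`. -/
def isFP : ObjectProperty (CMod C) := fun M =>
  ∃ (X₀ X₁ : C) (f : rep X₀ ⟶ rep X₁) (g : rep X₁ ⟶ M) (w : f ≫ g = 0),
    (ShortComplex.mk f g w).Exact ∧ Epi g

/-- `mod(C)`: the full subcategory of `Mod(C)` of finitely presented modules. -/
abbrev FPMod : Type (u + 1) := (isFP C).FullSubcategory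

variable {C}

lemma rep_hom_app {X Y : C} {M : CMod C} (φ : rep X ⟶ M) (f : X ⟶ Y) :
    φ.hom.app Y (show (rep X).obj.obj Y from f) = M.obj.map f (φ.hom.app X (𝟙 X : X ⟶ X)) :=
  (congrArg (φ.hom.app Y) (Category.id_comp f).symm).trans (hom_app_map φ f (𝟙 X : X ⟶ X))

lemma isFP_iff (M : CMod C) :
    isFP C M ↔ ∃ (B : C) (b : M.obj.obj B) (A : C) (h : B ⟶ A),
      (∀ (X : C) (m : M.obj.obj X), ∃ f : B ⟶ X, M.obj.map f b = m) ∧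
      M.obj.map h b = 0 ∧
      ∀ (X : C) (f : B ⟶ X), M.obj.map f b = 0 → ∃ g : A ⟶ X, h ≫ g = f := by
  constructor
  · rintro ⟨A, B, f, g, w, hex, hg⟩
    rw [exact_iff] at hex
    rw [epi_iff] at hg
    refine ⟨B, g.hom.app B (𝟙 B : B ⟶ B), A, f.hom.app A (𝟙 A : A ⟶ A), ?_, ?_, ?_⟩
    · intro X m
      obtain ⟨k, hk⟩ := hg X m
      exact ⟨k, (rep_hom_app g k).symm.trans hk⟩
    · refine (rep_hom_app g (show B ⟶ A from f.hom.app A (𝟙 A : A ⟶ A))).symm.trans ?_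
      exact congrArg (fun φ => φ.hom.app A (𝟙 A : A ⟶ A)) w
    · intro X k hk
      obtain ⟨l, hl⟩ := (hex X k).1 ((rep_hom_app g k).trans hk)
      exact ⟨l, (rep_hom_app f l).symm.trans hl⟩
  · rintro ⟨B, b, A, h, h1, h2, h3⟩
    have w : repHom (show (rep B).obj.obj A from h) ≫ repHom b = 0 := by
      refine rep_hom_ext ?_
      change M.obj.map (h ≫ 𝟙 A) b = 0
      rw [Category.comp_id, h2]
    refine ⟨A, B, repHom (show (rep B).obj.obj A from h), repHom b, w, ?_, ?_⟩
    · rw [exact_iff]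
      intro X f
      constructor
      · intro hf
        exact h3 X f hf
      · rintro ⟨g, rfl⟩
        exact congrArg (fun φ => φ.hom.app X g) w
    · rw [epi_iff]
      exact h1

lemma isFP_rep [HasZeroObject C] (X : C) : isFP C (rep X) := by
  rw [isFP_iff]
  refine ⟨X, (𝟙 X : X ⟶ X), 0, 0, fun Y m => ⟨m, Category.id_comp (show X ⟶ Y from m)⟩,
    (isZero_zero C).eq_of_tgt _ _, fun Y f hf => ⟨0, ?_⟩⟩
  have : f = 0 := (Category.id_comp f).symm.trans hf
  rw [this, comp_zero]

instance [HasZeroObject C] : (isFP C).ContainsZero where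
  exists_zero := by
    refine ⟨0, isZero_zero _, ?_⟩
    have hz (X : C) (m n : (0 : CMod C).obj.obj X) : m = n := by
      have e := congrArg (fun φ => φ.hom.app X) ((isZero_zero (CMod C)).eq_of_src (𝟙 _) 0)
      exact (ConcreteCategory.congr_hom e m).trans (ConcreteCategory.congr_hom e n).symm
    rw [isFP_iff]
    exact ⟨0, 0, 0, 𝟙 _, fun X m => ⟨0, hz _ _ _⟩, hz _ _ _, fun X f _ => ⟨f, (isZero_zero C).eq_of_src _ _⟩⟩

/-- Finite presentation passes to cokernels. -/
lemma isFP_of_exact [HasBinaryBiproducts C] {M N Q : CMod C} (φ : M ⟶ N) (q : N ⟶ Q)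
    (hq : ∀ X, Function.Surjective (q.hom.app X))
    (hex : ∀ X, Function.Exact (φ.hom.app X) (q.hom.app X))
    (hM : isFP C M) (hN : isFP C N) : isFP C Q := by
  rw [isFP_iff] at hM hN ⊢
  obtain ⟨B, b, A, h, hb, h0, hA⟩ := hM
  obtain ⟨B', b', A', h', hb', h0', hA'⟩ := hN
  obtain ⟨k, hk⟩ := hb' B (φ.hom.app B b)
  have hqφ (X) (m : M.obj.obj X) : q.hom.app X (φ.hom.app X m) = 0 := (hex X _).2 ⟨m, rfl⟩
  refine ⟨B', q.hom.app B' b', B ⊞ A', biprod.lift k h', ?_, ?_, ?_⟩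
  · intro X y
    obtain ⟨n, rfl⟩ := hq X y
    obtain ⟨f, rfl⟩ := hb' X n
    exact ⟨f, (hom_app_map q f b').symm⟩
  · rw [← hom_app_map, biprod.lift_eq, N.obj.map_add]
    change q.hom.app _ (N.obj.map (k ≫ biprod.inl) b' + N.obj.map (h' ≫ biprod.inr) b') = 0
    rw [N.obj.map_comp, N.obj.map_comp, AddCommGrpCat.comp_apply, AddCommGrpCat.comp_apply,
      hk, h0', map_zero, add_zero, ← hom_app_map, hqφ]
  · intro X f hf
    rw [← hom_app_map] at hf
    obtain ⟨m, hm⟩ := (hex X _).1 hf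
    obtain ⟨g, rfl⟩ := hb X m
    have : N.obj.map (f - k ≫ g) b' = 0 := by
      rw [N.obj.map_sub]
      change N.obj.map f b' - N.obj.map (k ≫ g) b' = 0
      rw [N.obj.map_comp, AddCommGrpCat.comp_apply, hk, ← hom_app_map, hm, sub_self]
    obtain ⟨l, hl⟩ := hA' X _ this
    exact ⟨biprod.desc g l, by simp [hl]⟩

instance [HasBinaryBiproducts C] : (isFP C).IsClosedUnderCokernels where
  cokernels_le := by
    rintro _ ⟨f, k, hk, hf⟩
    have h1 : Epi k.π := Cofork.IsColimit.epi hk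
    have h2 : (ShortComplex.mk f k.π k.condition).Exact :=
      ShortComplex.exact_of_g_is_cokernel _ (hk.ofIsoColimit (Cofork.ext (Iso.refl _)))
    exact isFP_of_exact f k.π ((epi_iff _).1 h1) ((exact_iff _).1 h2) hf.1 hf.2

instance [HasBinaryBiproducts C] : (isFP C).IsClosedUnderIsomorphisms where
  of_iso {M N} e hM := by
    refine isFP_of_exact (0 : M ⟶ M) e.hom ((epi_iff _).1 inferInstance) (fun X m => ?_) hM hM
    constructor
    · intro h
      exact ⟨0, (((mono_iff e.hom).1 inferInstance X) (h.trans (map_zero _).symm)).symm⟩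
    · rintro ⟨y, rfl⟩
      exact map_zero (e.hom.hom.app X).hom

lemma isFP_biprod [HasBinaryBiproducts C] (M N : CMod C) (hM : isFP C M) (hN : isFP C N) :
    isFP C (M ⊞ N) := by
  rw [isFP_iff] at hM hN ⊢
  obtain ⟨B, b, A, h, hb, h0, hA⟩ := hM
  obtain ⟨B', b', A', h', hb', h0', hA'⟩ := hN
  let i₁ : M ⟶ M ⊞ N := biprod.inl
  let i₂ : N ⟶ M ⊞ N := biprod.inr
  let p₁ : M ⊞ N ⟶ M := biprod.fst
  let p₂ : M ⊞ N ⟶ N := biprod.snd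
  have e₁₁ (X) (m : M.obj.obj X) : p₁.hom.app X (i₁.hom.app X m) = m :=
    congrArg (fun φ => φ.hom.app X m) (biprod.inl_fst : i₁ ≫ p₁ = 𝟙 M)
  have e₁₂ (X) (m : M.obj.obj X) : p₂.hom.app X (i₁.hom.app X m) = 0 :=
    congrArg (fun φ => φ.hom.app X m) (biprod.inl_snd : i₁ ≫ p₂ = 0)
  have e₂₁ (X) (m : N.obj.obj X) : p₁.hom.app X (i₂.hom.app X m) = 0 :=
    congrArg (fun φ => φ.hom.app X m) (biprod.inr_fst : i₂ ≫ p₁ = 0)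
  have e₂₂ (X) (m : N.obj.obj X) : p₂.hom.app X (i₂.hom.app X m) = m :=
    congrArg (fun φ => φ.hom.app X m) (biprod.inr_snd : i₂ ≫ p₂ = 𝟙 N)
  have tot (X) (m : (M ⊞ N).obj.obj X) :
      i₁.hom.app X (p₁.hom.app X m) + i₂.hom.app X (p₂.hom.app X m) = m :=
    congrArg (fun φ => φ.hom.app X m) (biprod.total : p₁ ≫ i₁ + p₂ ≫ i₂ = 𝟙 (M ⊞ N))
  let c : (M ⊞ N).obj.obj (B ⊞ B') :=
    (M ⊞ N).obj.map biprod.inl (i₁.hom.app B b) + (M ⊞ N).obj.map biprod.inr (i₂.hom.app B' b')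
  have hc (X) (f : B ⊞ B' ⟶ X) : (M ⊞ N).obj.map f c =
      i₁.hom.app X (M.obj.map (biprod.inl ≫ f) b) +
        i₂.hom.app X (N.obj.map (biprod.inr ≫ f) b') := by
    simp only [c, map_add, hom_app_map, Functor.map_comp, AddCommGrpCat.comp_apply]
  refine ⟨B ⊞ B', c, A ⊞ A', biprod.map h h', fun X m => ?_, ?_, fun X f hf => ?_⟩
  · obtain ⟨f, hf⟩ := hb X (p₁.hom.app X m)
    obtain ⟨f', hf'⟩ := hb' X (p₂.hom.app X m)
    exact ⟨biprod.desc f f', by rw [hc, biprod.inl_desc, biprod.inr_desc, hf, hf', tot]⟩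
  · rw [hc, biprod.inl_map, biprod.inr_map, Functor.map_comp, Functor.map_comp,
      AddCommGrpCat.comp_apply, AddCommGrpCat.comp_apply, h0, h0']
    simp only [map_zero, add_zero]
  · rw [hc] at hf
    have k₁ := congrArg (p₁.hom.app X) hf
    have k₂ := congrArg (p₂.hom.app X) hf
    simp only [map_add, map_zero, e₁₁, e₁₂, e₂₁, e₂₂, add_zero, zero_add] at k₁ k₂
    obtain ⟨g, hg⟩ := hA X _ k₁
    obtain ⟨g', hg'⟩ := hA' X _ k₂
    exact ⟨biprod.desc g g', by ext <;> simp [hg, hg']⟩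

instance [HasBinaryBiproducts C] : (isFP C).IsClosedUnderBinaryProducts where
  limitsOfShape_le := by
    rintro X ⟨p⟩
    exact (isFP C).prop_of_iso
      (IsLimit.conePointsIsoOfNatIso p.isLimit (BinaryBiproduct.isLimit _ _)
        (diagramIsoPair p.diag)).symm
      (isFP_biprod _ _ (p.prop_diag_obj ⟨.left⟩) (p.prop_diag_obj ⟨.right⟩))


variable [HasZeroObject C] [HasBinaryBiproducts C]

instance : (isFP C).IsClosedUnderFiniteProducts := .mk'

instance [(isFP C).IsClosedUnderKernels] : PreservesFiniteLimits (isFP C).ι :=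
  have := (isFP C).preservesKernels_ι
  Functor.preservesFiniteLimits_of_preservesKernels _

instance [(isFP C).IsClosedUnderKernels] : PreservesFiniteColimits (isFP C).ι :=
  have := (isFP C).preservesCokernels_ι
  Functor.preservesFiniteColimits_of_preservesCokernels _

instance [(isFP C).IsClosedUnderKernels] : EnoughProjectives (FPMod C) where
  presentation M := by
    obtain ⟨X₀, X₁, f, g, w, hex, hg⟩ := M.property
    refine ⟨{ p := ⟨rep X₁, isFP_rep X₁⟩, projective := ⟨fun {E N} k e he => ?_⟩,
              f := ObjectProperty.homMk g, epi := ?_ }⟩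
    · have : Epi e.hom := (inferInstance : Epi ((isFP C).ι.map e))
      exact ⟨ObjectProperty.homMk (Projective.factorThru k.hom e.hom),
        ObjectProperty.hom_ext _ (Projective.factorThru_comp k.hom e.hom)⟩
    · exact (isFP C).ι.epi_of_epi_map hg

instance [(isFP C).IsClosedUnderKernels] : HasExt.{u} (FPMod C) := hasExt_of_enoughProjectives _

/-- If the category `mod(C)` has kernels, then they are kernels in `Mod(C)`. -/
lemma isClosedUnderKernels_of_hasKernels [HasKernels (FPMod C)] :
    (isFP C).IsClosedUnderKernels where
  kernels_le := by
    rintro _ ⟨f, k, hk, hM, hN⟩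
    rename_i M N
    let f' : (⟨M, hM⟩ : FPMod C) ⟶ ⟨N, hN⟩ := ObjectProperty.homMk f
    let i : (kernel f').obj ⟶ M := (kernel.ι f').hom
    have w : i ≫ f = 0 := congrArg (fun φ => φ.hom) (kernel.condition f')
    let j : (kernel f').obj ⟶ k.pt := Fork.IsLimit.lift' hk i (by rw [w, comp_zero])
    have hj : j ≫ k.ι = i := (Fork.IsLimit.lift' hk i (by rw [w, comp_zero])).2
    have hkm : Mono k.ι := Fork.IsLimit.mono hk
    have hepi : Epi j := by
      rw [epi_iff]
      intro X x
      let r : (⟨rep X, isFP_rep X⟩ : FPMod C) ⟶ ⟨M, hM⟩ :=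
        ObjectProperty.homMk (repHom (k.ι.hom.app X x))
      have hr : r ≫ f' = 0 := by
        apply ObjectProperty.hom_ext
        refine rep_hom_ext ?_
        change f.hom.app X (M.obj.map (𝟙 X) (k.ι.hom.app X x)) = 0
        rw [M.obj.map_id]
        exact congrArg (fun φ => φ.hom.app X x) (KernelFork.condition k)
      refine ⟨(kernel.lift f' r hr).hom.hom.app X (𝟙 X : X ⟶ X), ?_⟩
      apply (mono_iff k.ι).1 hkm X
      have h1 := congrArg (fun φ => φ.hom.hom.app X (𝟙 X : X ⟶ X)) (kernel.lift_ι f' r hr)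
      have h2 := congrArg (fun φ => φ.hom.app X ((kernel.lift f' r hr).hom.hom.app X
        (𝟙 X : X ⟶ X))) hj
      refine h2.trans (h1.trans ?_)
      change M.obj.map (𝟙 X) (k.ι.hom.app X x) = _
      rw [M.obj.map_id]
      rfl
    have hmono : Mono j := by
      rw [mono_iff]
      intro X
      rw [injective_iff_map_eq_zero]
      intro a ha
      have hi : i.hom.app X a = 0 := by
        have := congrArg (fun φ => φ.hom.app X a) hj
        refine this.symm.trans ?_
        change k.ι.hom.app X (j.hom.app X a) = 0
        rw [ha, map_zero]
      let r : (⟨rep X, isFP_rep X⟩ : FPMod C) ⟶ kernel f' := ObjectProperty.homMk (repHom a)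
      have hr : r = 0 := by
        rw [← cancel_mono (kernel.ι f'), zero_comp]
        apply ObjectProperty.hom_ext
        refine rep_hom_ext ?_
        change i.hom.app X ((kernel f').obj.obj.map (𝟙 X) a) = 0
        rw [CategoryTheory.Functor.map_id]
        exact hi
      have := congrArg (fun φ => φ.hom.hom.app X (𝟙 X : X ⟶ X)) hr
      change (kernel f').obj.obj.map (𝟙 X) a = 0 at this
      rw [CategoryTheory.Functor.map_id] at this
      exact this
    have : IsIso j := isIso_of_mono_of_epi j
    exact (isFP C).prop_of_iso (asIso j) (kernel f').property

end FinitelyPresented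

section Restriction

variable {C D : Type u} [Category.{u} C] [Preadditive C] [Category.{u} D] [Preadditive D]
  (F : C ⥤ D) [F.Additive]

/-- Restriction of modules along an additive functor. -/
def res : CMod D ⥤ CMod C :=
  (additiveFunctor C AddCommGrpCat.{u}).lift
    (AdditiveFunctor.forget D AddCommGrpCat.{u} ⋙ (Functor.whiskeringLeft C D _).obj F)
    fun M => (inferInstance : (F ⋙ M.obj).Additive)

instance : (res F).Additive where

instance : PreservesFiniteLimits (res F) :=
  have : PreservesFiniteLimits (res F ⋙ AdditiveFunctor.forget C AddCommGrpCat.{u}) :=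
    (inferInstance : PreservesFiniteLimits
      (AdditiveFunctor.forget D AddCommGrpCat.{u} ⋙ (Functor.whiskeringLeft C D _).obj F))
  preservesFiniteLimits_of_reflects_of_preserves _ (AdditiveFunctor.forget C AddCommGrpCat.{u})

instance : PreservesFiniteColimits (res F) :=
  have : PreservesFiniteColimits (res F ⋙ AdditiveFunctor.forget C AddCommGrpCat.{u}) :=
    (inferInstance : PreservesFiniteColimits
      (AdditiveFunctor.forget D AddCommGrpCat.{u} ⋙ (Functor.whiskeringLeft C D _).obj F))
  preservesFiniteColimits_of_reflects_of_preserves _ (AdditiveFunctor.forget C AddCommGrpCat.{u})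

end Restriction


section Ideals

/-- A two-sided ideal of a preadditive category: subgroups `I(X, Y)` of `Hom(X, Y)` stable under
composition on both sides. -/
structure CatIdeal (C : Type u) [Category.{u} C] [Preadditive C] where
  hom (X Y : C) : AddSubgroup (X ⟶ Y)
  comp_mem {W X Y Z : C} (g : W ⟶ X) {f : X ⟶ Y} (hf : f ∈ hom X Y) (h : Y ⟶ Z) :
    g ≫ f ≫ h ∈ hom W Z

variable {C : Type u} [Category.{u} C] [Preadditive C]

namespace CatIdeal

variable (I : CatIdeal C)

lemma comp_mem_left {W X Y : C} (g : W ⟶ X) {f : X ⟶ Y} (hf : f ∈ I.hom X Y) :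
    g ≫ f ∈ I.hom W Y := by
  simpa using I.comp_mem g hf (𝟙 Y)

lemma comp_mem_right {X Y Z : C} {f : X ⟶ Y} (hf : f ∈ I.hom X Y) (h : Y ⟶ Z) :
    f ≫ h ∈ I.hom X Z := by
  simpa using I.comp_mem (𝟙 X) hf h

/-- The ideal of the opposite category -/
def op : CatIdeal Cᵒᵖ where
  hom X Y := (I.hom Y.unop X.unop).comap (AddMonoidHom.mk' (fun f => f.unop) fun _ _ => rfl)
  comp_mem g f hf h := by
    change (g ≫ f ≫ h).unop ∈ I.hom _ _
    rw [unop_comp, unop_comp, Category.assoc]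
    exact I.comp_mem h.unop hf g.unop

/-- The module `I(X, -)`. -/
def left (X : C) : CMod C where
  obj :=
    { obj := fun Y => AddCommGrpCat.of (I.hom X Y)
      map := fun {Y Z} h => AddCommGrpCat.ofHom
        (AddMonoidHom.mk' (fun f => ⟨f.1 ≫ h, I.comp_mem_right f.2 h⟩)
          fun f g => Subtype.ext (Preadditive.add_comp _ _ _ _ _ _))
      map_id := fun Y => by
        ext f
        exact Category.comp_id f.1
      map_comp := fun g h => by
        ext f
        exact (Category.assoc f.1 g h).symm }
  property := ⟨fun {Y Z g h} => by
    ext f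
    exact Preadditive.comp_add _ _ _ f.1 g h⟩

/-- Property (A): for each `X` there are epimorphisms `Hom(Y, -) ⟶ I(X, -)` in `Mod(C)` and
`Hom(-, Y) ⟶ I(-, X)` in `Mod(Cᵒᵖ)`. -/
structure PropertyA : Prop where
  left (X : C) : ∃ (Y : C) (p : rep Y ⟶ I.left X), Epi p
  right (X : C) : ∃ (Y : C) (p : rep (Opposite.op Y) ⟶ I.op.left (Opposite.op X)), Epi p

/-- Congruence modulo `I`. -/
def rel : HomRel C := fun X Y f g => f - g ∈ I.hom X Y

instance : Congruence I.rel where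
  comp_left {X Y Z} f {g g'} h := by
    change f ≫ g - f ≫ g' ∈ _
    rw [← Preadditive.comp_sub]
    exact I.comp_mem_left f h
  comp_right g h := by
    change _ ≫ g - _ ≫ g ∈ _
    rw [← Preadditive.sub_comp]
    exact I.comp_mem_right h g
  equivalence :=
    { refl := fun f => by change f - f ∈ _; simp
      symm := fun {f g} h => by
        change g - f ∈ _
        rw [← neg_sub]
        exact neg_mem h
      trans := fun {f g k} h h' => by
        change f - k ∈ _
        rw [← sub_add_sub_cancel f g k]
        exact add_mem h h' }

/-- The quotient category `C/I`. -/
abbrev Quot : Type u := Quotient I.rel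

lemma rel_add ⦃X Y : C⦄ (f₁ f₂ g₁ g₂ : X ⟶ Y) (hf : I.rel f₁ f₂) (hg : I.rel g₁ g₂) :
    I.rel (f₁ + g₁) (f₂ + g₂) := by
  change _ - _ ∈ _
  rw [add_sub_add_comm]
  exact add_mem hf hg

instance : Preadditive I.Quot := Quotient.preadditive I.rel I.rel_add

/-- The canonical functor `π : C ⥤ C/I`. -/
abbrev π : C ⥤ I.Quot := Quotient.functor I.rel

instance : I.π.Additive := Quotient.functor_additive I.rel I.rel_add

lemma π_map_eq_iff {X Y : C} (f g : X ⟶ Y) : I.π.map f = I.π.map g ↔ f - g ∈ I.hom X Y :=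
  Quotient.functor_map_eq_iff I.rel f g

instance [HasZeroObject C] : HasZeroObject I.Quot := Functor.hasZeroObject_of_additive I.π

instance [HasZeroObject C] [HasBinaryBiproducts C] : HasBinaryBiproducts I.Quot :=
  have : HasFiniteProducts C := hasFiniteProducts_of_has_binary_and_terminal
  have : HasFiniteProducts I.Quot := Functor.hasFiniteProducts_of_additive_of_essSurj I.π
  HasBinaryBiproducts.of_hasBinaryProducts

/-- Restriction `π_* : Mod(C/I) ⥤ Mod(C)`, `F ↦ F ∘ π`. -/
abbrev πStar : CMod I.Quot ⥤ CMod C := res I.π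

/-- Restriction `Mod((C/I)ᵒᵖ) ⥤ Mod(Cᵒᵖ)`. -/
abbrev πStarOp : CMod I.Quotᵒᵖ ⥤ CMod Cᵒᵖ := res I.π.op

variable {I}

lemma PropertyA.exists_generator (hI : I.PropertyA) (X : C) :
    ∃ (Y : C) (i : X ⟶ Y), i ∈ I.hom X Y ∧
      ∀ (Z : C) (f : X ⟶ Z), f ∈ I.hom X Z → ∃ g : Y ⟶ Z, i ≫ g = f := by
  obtain ⟨Y, p, hp⟩ := hI.left X
  rw [epi_iff] at hp
  let i : I.hom X Y := p.hom.app Y (𝟙 Y : Y ⟶ Y)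
  refine ⟨Y, i.1, i.2, fun Z f hf => ?_⟩
  obtain ⟨g, hg⟩ := hp Z (show (I.left X).obj.obj Z from (⟨f, hf⟩ : I.hom X Z))
  refine ⟨g, ?_⟩
  exact congrArg Subtype.val (show (show I.hom X Z from (I.left X).obj.map (show Y ⟶ Z from g) i) =
    ⟨f, hf⟩ from (rep_hom_app p g).symm.trans hg)

lemma PropertyA.isFP_πStar [HasZeroObject C] [HasBinaryBiproducts C] (hI : I.PropertyA)
    (M : CMod I.Quot) (hM : isFP I.Quot M) : isFP C (I.πStar.obj M) := by
  rw [isFP_iff] at hM ⊢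
  obtain ⟨⟨B⟩, b, ⟨A⟩, h, hb, h0, hA⟩ := hM
  obtain ⟨h, rfl⟩ := I.π.map_surjective (X := B) (Y := A) h
  obtain ⟨Y, i, hi, hY⟩ := hI.exists_generator B
  refine ⟨B, b, A ⊞ Y, biprod.lift h i, fun X m => ?_, ?_, fun X f hf => ?_⟩
  · obtain ⟨f, hf⟩ := hb (I.π.obj X) m
    obtain ⟨f, rfl⟩ := I.π.map_surjective (X := B) (Y := X) f
    exact ⟨f, hf⟩
  · have e1 : biprod.lift h i = h ≫ biprod.inl + i ≫ biprod.inr := biprod.lift_eq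
    have e2 : I.π.map (biprod.lift h i) = I.π.map h ≫ I.π.map biprod.inl := by
      rw [← Functor.map_comp, π_map_eq_iff, e1, add_sub_cancel_left]
      exact I.comp_mem_right hi _
    change M.obj.map (I.π.map (biprod.lift h i)) b = 0
    rw [e2, Functor.map_comp, AddCommGrpCat.comp_apply, h0, map_zero]
  · obtain ⟨g, hg⟩ := hA (I.π.obj X) (I.π.map f) hf
    obtain ⟨g, rfl⟩ := I.π.map_surjective (X := A) (Y := X) g
    rw [← Functor.map_comp, π_map_eq_iff] at hg
    obtain ⟨g', hg'⟩ := hY X _ hg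
    refine ⟨biprod.desc g (-g'), ?_⟩
    rw [biprod.lift_desc, Preadditive.comp_neg, hg']
    abel

lemma isFP_of_isFP_πStar (M : CMod I.Quot) (hM : isFP C (I.πStar.obj M)) : isFP I.Quot M := by
  rw [isFP_iff] at hM ⊢
  obtain ⟨B, b, A, h, hb, h0, hA⟩ := hM
  refine ⟨I.π.obj B, b, I.π.obj A, I.π.map h, fun ⟨X⟩ m => ?_, h0, fun ⟨X⟩ f hf => ?_⟩
  · obtain ⟨f, hf⟩ := hb X m
    exact ⟨I.π.map f, hf⟩
  · obtain ⟨f, rfl⟩ := I.π.map_surjective (X := B) (Y := X) f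
    obtain ⟨g, rfl⟩ := hA X f hf
    exact ⟨I.π.map g, (I.π.map_comp h g).symm⟩

lemma PropertyA.isClosedUnderKernels_quot [HasZeroObject C] [HasBinaryBiproducts C]
    (hI : I.PropertyA) [(isFP C).IsClosedUnderKernels] :
    (isFP I.Quot).IsClosedUnderKernels where
  kernels_le := by
    rintro _ ⟨f, k, hk, hM, hN⟩
    apply isFP_of_isFP_πStar
    have := (KernelFork.isLimitMapConeEquiv _ I.πStar) (isLimitOfPreserves I.πStar hk)
    exact (isFP C).prop_of_isLimit_kernelFork this (hI.isFP_πStar _ hM) (hI.isFP_πStar _ hN)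

/-- `π_* : mod(C/I) ⥤ mod(C)`. -/
def PropertyA.πStarFP [HasZeroObject C] [HasBinaryBiproducts C] (hI : I.PropertyA) :
    FPMod I.Quot ⥤ FPMod C :=
  (isFP C).lift ((isFP I.Quot).ι ⋙ I.πStar) fun M => hI.isFP_πStar _ M.property

section
variable [HasZeroObject C] [HasBinaryBiproducts C] (hI : I.PropertyA)

instance : hI.πStarFP.Additive where

variable [(isFP C).IsClosedUnderKernels] [(isFP I.Quot).IsClosedUnderKernels]

instance : PreservesFiniteLimits hI.πStarFP :=
  have : PreservesFiniteLimits (hI.πStarFP ⋙ (isFP C).ι) :=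
    (inferInstance : PreservesFiniteLimits ((isFP I.Quot).ι ⋙ I.πStar))
  preservesFiniteLimits_of_reflects_of_preserves _ (isFP C).ι

instance : PreservesFiniteColimits hI.πStarFP :=
  have : PreservesFiniteColimits (hI.πStarFP ⋙ (isFP C).ι) :=
    (inferInstance : PreservesFiniteColimits ((isFP I.Quot).ι ⋙ I.πStar))
  preservesFiniteColimits_of_reflects_of_preserves _ (isFP C).ι

end

end CatIdeal

end Ideals


section Tensor

variable {C : Type u} [Category.{u} C] [Preadditive C]

/-- The defining relations of `N ⊗_C M`: biadditivity, and `n f ⊗ m = n ⊗ f m` for `f : X ⟶ Y`. -/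
inductive TensorRel (N : CMod Cᵒᵖ) (M : CMod C) :
    FreeAbelianGroup (Σ X : C, N.obj.obj (op X) × M.obj.obj X) → Prop
  | add_left (X : C) (n n' : N.obj.obj (op X)) (m : M.obj.obj X) :
      TensorRel N M (.of ⟨X, n + n', m⟩ - .of ⟨X, n, m⟩ - .of ⟨X, n', m⟩)
  | add_right (X : C) (n : N.obj.obj (op X)) (m m' : M.obj.obj X) :
      TensorRel N M (.of ⟨X, n, m + m'⟩ - .of ⟨X, n, m⟩ - .of ⟨X, n, m'⟩)
  | balanced {X Y : C} (f : X ⟶ Y) (n : N.obj.obj (op Y)) (m : M.obj.obj X) :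
      TensorRel N M (.of ⟨X, N.obj.map f.op n, m⟩ - .of ⟨Y, n, M.obj.map f m⟩)

/-- The tensor product `N ⊗_C M`, generated by symbols `n ⊗ m` with `n ∈ N(X)` and `m ∈ M(X)`. -/
def tensorObj (N : CMod Cᵒᵖ) (M : CMod C) : AddCommGrpCat.{u} :=
  AddCommGrpCat.of (FreeAbelianGroup (Σ X : C, N.obj.obj (op X) × M.obj.obj X) ⧸
    AddSubgroup.closure {x | TensorRel N M x})

/-- The element `n ⊗ m`. -/
def tmul (N : CMod Cᵒᵖ) (M : CMod C) (X : C) (n : N.obj.obj (op X)) (m : M.obj.obj X) :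
    tensorObj N M :=
  QuotientAddGroup.mk (FreeAbelianGroup.of ⟨X, n, m⟩)

section

variable {N : CMod Cᵒᵖ} {M : CMod C}

lemma tmul_add_left (X : C) (n n' : N.obj.obj (op X)) (m : M.obj.obj X) :
    tmul N M X (n + n') m = tmul N M X n m + tmul N M X n' m := by
  rw [← sub_eq_zero, ← sub_sub]
  exact (QuotientAddGroup.eq_zero_iff _).2
    (AddSubgroup.subset_closure (TensorRel.add_left X n n' m))

lemma tmul_add_right (X : C) (n : N.obj.obj (op X)) (m m' : M.obj.obj X) :
    tmul N M X n (m + m') = tmul N M X n m + tmul N M X n m' := by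
  rw [← sub_eq_zero, ← sub_sub]
  exact (QuotientAddGroup.eq_zero_iff _).2
    (AddSubgroup.subset_closure (TensorRel.add_right X n m m'))

lemma tmul_balanced {X Y : C} (f : X ⟶ Y) (n : N.obj.obj (op Y)) (m : M.obj.obj X) :
    tmul N M X (N.obj.map f.op n) m = tmul N M Y n (M.obj.map f m) := by
  rw [← sub_eq_zero]
  exact (QuotientAddGroup.eq_zero_iff _).2
    (AddSubgroup.subset_closure (TensorRel.balanced f n m))

lemma tensorObj_hom_ext {A : AddCommGrpCat.{u}} {f g : tensorObj N M ⟶ A}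
    (h : ∀ X n m, f (tmul N M X n m) = g (tmul N M X n m)) : f = g := by
  apply AddCommGrpCat.hom_ext
  apply QuotientAddGroup.addMonoidHom_ext
  apply FreeAbelianGroup.lift_ext
  rintro ⟨X, n, m⟩
  exact h X n m

/-- Balanced biadditive families induce homomorphisms on the tensor product. -/
def tensorLift {A : AddCommGrpCat.{u}} (φ : ∀ X : C, N.obj.obj (op X) → M.obj.obj X → A)
    (hl : ∀ X n n' m, φ X (n + n') m = φ X n m + φ X n' m)
    (hr : ∀ X n m m', φ X n (m + m') = φ X n m + φ X n m')
    (hb : ∀ {X Y : C} (f : X ⟶ Y) n m, φ X (N.obj.map f.op n) m = φ Y n (M.obj.map f m)) :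
    tensorObj N M ⟶ A :=
  AddCommGrpCat.ofHom (QuotientAddGroup.lift _
    (FreeAbelianGroup.lift fun i => φ i.1 i.2.1 i.2.2) (by
      rw [AddSubgroup.closure_le]
      rintro x (⟨X, n, n', m⟩ | ⟨X, n, m, m'⟩ | ⟨f, n, m⟩)
      · simp [hl]
      · simp [hr]
      · simp [hb]))

@[simp]
lemma tensorLift_tmul {A : AddCommGrpCat.{u}} (φ : ∀ X : C, N.obj.obj (op X) → M.obj.obj X → A)
    (hl) (hr) (hb : ∀ {X Y : C} (f : X ⟶ Y) n m,
      φ X (N.obj.map f.op n) m = φ Y n (M.obj.map f m)) (X : C) (n) (m) :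
    tensorLift φ hl hr hb (tmul N M X n m) = φ X n m :=
  FreeAbelianGroup.lift_apply_of _ _

end

/-- Functoriality of the tensor product. -/
def tensorMap {N N' : CMod Cᵒᵖ} {M M' : CMod C} (φ : N ⟶ N') (ψ : M ⟶ M') :
    tensorObj N M ⟶ tensorObj N' M' :=
  tensorLift (fun X n m => tmul N' M' X (φ.hom.app (op X) n) (ψ.hom.app X m))
    (fun X n n' m => by rw [map_add, tmul_add_left])
    (fun X n m m' => by rw [map_add, tmul_add_right])
    (fun f n m => by rw [hom_app_map, hom_app_map, tmul_balanced])

@[simp]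
lemma tensorMap_tmul {N N' : CMod Cᵒᵖ} {M M' : CMod C} (φ : N ⟶ N') (ψ : M ⟶ M') (X : C) (n) (m) :
    tensorMap φ ψ (tmul N M X n m) = tmul N' M' X (φ.hom.app (op X) n) (ψ.hom.app X m) :=
  FreeAbelianGroup.lift_apply_of _ _

/-- The bifunctor `- ⊗_C -`. -/
def tensor : CMod Cᵒᵖ ⥤ CMod C ⥤ AddCommGrpCat.{u} where
  obj N :=
    { obj := fun M => tensorObj N M
      map := fun ψ => tensorMap (𝟙 N) ψ
      map_id := fun M => tensorObj_hom_ext fun X n m => tensorMap_tmul _ _ X n m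
      map_comp := fun φ ψ => tensorObj_hom_ext fun X n m => by
        simp only [AddCommGrpCat.comp_apply, tensorMap_tmul]
        rfl }
  map φ :=
    { app := fun M => tensorMap φ (𝟙 M)
      naturality := fun M M' ψ => tensorObj_hom_ext fun X n m => by
        simp only [AddCommGrpCat.comp_apply, tensorMap_tmul]
        rfl }
  map_id N := by
    ext M : 2
    exact tensorObj_hom_ext fun X n m => tensorMap_tmul _ _ X n m
  map_comp φ ψ := by
    ext M : 2
    refine tensorObj_hom_ext fun X n m => ?_
    simp only [NatTrans.comp_app, AddCommGrpCat.comp_apply, tensorMap_tmul]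
    rfl

instance (N : CMod Cᵒᵖ) : (tensor.obj N).Additive where
  map_add {M M' φ ψ} := tensorObj_hom_ext fun X n m => by
    change tensorMap (𝟙 N) (φ + ψ) _ = tensorMap (𝟙 N) φ _ + tensorMap (𝟙 N) ψ _
    simp only [tensorMap_tmul]
    exact tmul_add_right _ _ _ _

instance (M : CMod C) : (tensor.flip.obj M).Additive where
  map_add {N N' φ ψ} := tensorObj_hom_ext fun X n m => by
    change tensorMap (φ + ψ) (𝟙 M) _ = tensorMap φ (𝟙 M) _ + tensorMap ψ (𝟙 M) _
    simp only [tensorMap_tmul]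
    exact tmul_add_left _ _ _ _

/-- `Tor_i^C(N, -)`, the left derived functor of `N ⊗_C -`. -/
def Tor (i : ℕ) (N : CMod Cᵒᵖ) : CMod C ⥤ AddCommGrpCat.{u} := (tensor.obj N).leftDerived i

end Tensor

section Derived

variable {C : Type u} [Category.{u} C] [Preadditive C]

/-- `X ↦ Hom(X, -)` -/
def repFunctor : Cᵒᵖ ⥤ CMod C :=
  (additiveFunctor C AddCommGrpCat.{u}).lift preadditiveCoyoneda fun X => additive_coyonedaObj' X

/-- `X ↦ Hom(-, X)` -/
def corepFunctor : C ⥤ CMod Cᵒᵖ :=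
  (additiveFunctor Cᵒᵖ AddCommGrpCat.{u}).lift preadditiveYoneda fun X => additive_yonedaObj' X

instance : (repFunctor (C := C)).Additive where
  map_add {X Y f g} := by
    ext Z h
    exact Preadditive.add_comp _ _ _ f.unop g.unop h

instance : (corepFunctor (C := C)).Additive where
  map_add {X Y f g} := by
    ext Z h
    exact Preadditive.comp_add _ _ _ h f g

namespace CatIdeal

variable (I : CatIdeal C)

/-- The `C`-modules `C(X, -)/I(X, -)`, functorial in `X` in `C/I`. -/
def quotLeft : I.Quotᵒᵖ ⥤ CMod C := repFunctor ⋙ I.πStar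

/-- The `Cᵒᵖ`-modules `C(-, X)/I(-, X)`, functorial in `X` in `C/I`. -/
def quotRight : I.Quot ⥤ CMod Cᵒᵖ := corepFunctor ⋙ I.πStarOp

instance : I.quotLeft.Additive := (inferInstance : (repFunctor ⋙ I.πStar).Additive)
instance : I.quotRight.Additive := (inferInstance : (corepFunctor ⋙ I.πStarOp).Additive)

/-- The functor `C(C/I, -) : Mod(C) ⥤ Mod(C/I)`, `M ↦ (X ↦ Hom(C(X, -)/I(X, -), M))`. -/
def homQuot : CMod C ⥤ CMod I.Quot where
  obj M := ⟨I.quotLeft.rightOp ⋙ preadditiveYoneda.obj M,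
    (inferInstance : (I.quotLeft.rightOp ⋙ preadditiveYoneda.obj M).Additive)⟩
  map φ := ObjectProperty.homMk (Functor.whiskerLeft _ (preadditiveYoneda.map φ))

/-- The functor `C/I ⊗_C - : Mod(C) ⥤ Mod(C/I)`, `M ↦ (X ↦ C(-, X)/I(-, X) ⊗_C M)`. -/
def tensorQuot : CMod C ⥤ CMod I.Quot where
  obj M := ⟨I.quotRight ⋙ tensor.flip.obj M,
    (inferInstance : (I.quotRight ⋙ tensor.flip.obj M).Additive)⟩
  map φ := ObjectProperty.homMk (Functor.whiskerLeft _ (tensor.flip.map φ))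

instance : I.homQuot.Additive where
  map_add {M N φ ψ} := by
    ext X f
    exact Preadditive.comp_add _ _ _ f φ ψ

instance : I.tensorQuot.Additive where
  map_add {M N φ ψ} := by
    ext X : 3
    exact (tensor.obj (I.quotRight.obj X)).map_add

/-- `𝔼𝕏𝕋^i(C/I, -)`, the right derived functor of `C(C/I, -)`. -/
def EXT (i : ℕ) : CMod C ⥤ CMod I.Quot := I.homQuot.rightDerived i

/-- `𝕋𝕆ℝ_i(C/I, -)`, the left derived functor of `C/I ⊗_C -`. -/
def TOR (i : ℕ) : CMod C ⥤ CMod I.Quot := I.tensorQuot.leftDerived i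

end CatIdeal

end Derived

section Comparison

section Resolution

set_option linter.unusedSectionVars false

variable {A B : Type (u + 1)} [Category.{u} A] [Abelian A] [Category.{u} B] [Abelian B]
  (L : A ⥤ B) [L.Additive] [PreservesFiniteLimits L] [PreservesFiniteColimits L]
  {Z : A} (P : ProjectiveResolution (L.obj Z)) (Q : ProjectiveResolution Z)

/-- Degree zero of `resolutionLift`. -/
def resolutionLiftZero : P.complex.X 0 ⟶ L.obj (Q.complex.X 0) :=
  haveI : L.PreservesEpimorphisms := preservesEpimorphisms_of_preservesColimitsOfShape L
  haveI : Epi (L.map (Q.π.f 0)) := L.map_epi (Q.π.f 0)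
  Projective.factorThru (show P.complex.X 0 ⟶ L.obj ((ChainComplex.single₀ A).obj Z |>.X 0) from
    P.π.f 0) (L.map (Q.π.f 0))

lemma resolutionLiftZero_comp :
    resolutionLiftZero L P Q ≫ L.map (Q.π.f 0) = P.π.f 0 :=
  haveI : L.PreservesEpimorphisms := preservesEpimorphisms_of_preservesColimitsOfShape L
  haveI : Epi (L.map (Q.π.f 0)) := L.map_epi (Q.π.f 0)
  Projective.factorThru_comp (show P.complex.X 0 ⟶
    L.obj ((ChainComplex.single₀ A).obj Z |>.X 0) from P.π.f 0) (L.map (Q.π.f 0))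

lemma resolutionLift_exact_zero : (ShortComplex.mk (L.map (Q.complex.d 1 0)) (L.map (Q.π.f 0))
    (by rw [← L.map_comp, Q.complex_d_comp_π_f_zero, L.map_zero])).Exact :=
  Q.exact₀.map L

lemma resolutionLift_exact_succ (n : ℕ) : (ShortComplex.mk (L.map (Q.complex.d (n + 2) (n + 1)))
    (L.map (Q.complex.d (n + 1) n))
    (by rw [← L.map_comp, Q.complex.d_comp_d, L.map_zero])).Exact :=
  (Q.exact_succ n).map L

/-- Degree one of `resolutionLift`. -/
def resolutionLiftOne : P.complex.X 1 ⟶ L.obj (Q.complex.X 1) :=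
  (resolutionLift_exact_zero L Q).liftFromProjective
    (P.complex.d 1 0 ≫ resolutionLiftZero L P Q) (by
      change (P.complex.d 1 0 ≫ resolutionLiftZero L P Q) ≫ L.map (Q.π.f 0) = 0
      rw [Category.assoc, resolutionLiftZero_comp]
      exact P.complex_d_comp_π_f_zero)

/-- Inductive step of `resolutionLift`. -/
def resolutionLiftSucc (n : ℕ) (g : P.complex.X n ⟶ L.obj (Q.complex.X n))
    (g' : P.complex.X (n + 1) ⟶ L.obj (Q.complex.X (n + 1)))
    (w : g' ≫ L.map (Q.complex.d (n + 1) n) = P.complex.d (n + 1) n ≫ g) :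
    P.complex.X (n + 2) ⟶ L.obj (Q.complex.X (n + 2)) :=
  (resolutionLift_exact_succ L Q n).liftFromProjective (P.complex.d (n + 2) (n + 1) ≫ g') (by
    change (P.complex.d (n + 2) (n + 1) ≫ g') ≫ L.map (Q.complex.d (n + 1) n) = 0
    rw [Category.assoc, w, ← Category.assoc, P.complex.d_comp_d, zero_comp])

/-- For an exact functor `L` and projective resolutions `P` of `L Z` and `Q` of `Z`, a morphism of
complexes `P ⟶ L Q` lifting the identity of `L Z`. -/
def resolutionLift : P.complex ⟶ (L.mapHomologicalComplex (ComplexShape.down ℕ)).obj Q.complex :=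
  ChainComplex.mkHom _ _ (resolutionLiftZero L P Q) (resolutionLiftOne L P Q)
    ((resolutionLift_exact_zero L Q).liftFromProjective_comp _ _)
    fun n t => ⟨resolutionLiftSucc L P Q n t.1 t.2.1 t.2.2,
      (resolutionLift_exact_succ L Q n).liftFromProjective_comp _ _⟩

lemma resolutionLift_commutes :
    (resolutionLift L P Q).f 0 ≫ L.map (Q.π.f 0) = P.π.f 0 :=
  (congrArg (fun t => t ≫ L.map (Q.π.f 0)) (ChainComplex.mkHom_f_0 _ _ _ _ _ _)).trans
    (resolutionLiftZero_comp L P Q)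

end Resolution

namespace CatIdeal

variable {C : Type u} [Category.{u} C] [Preadditive C] (I : CatIdeal C)

/-- The canonical homomorphisms `(F ∘ π) ⊗_C (M ∘ π) ⟶ F ⊗_{C/I} M`, `x ⊗ y ↦ x ⊗ y`. -/
def tensorComparison (F : CMod I.Quotᵒᵖ) :
    I.πStar ⋙ tensor.obj (I.πStarOp.obj F) ⟶ tensor.obj F where
  app M := tensorLift (N := I.πStarOp.obj F) (M := I.πStar.obj M) (A := tensorObj F M)
    (fun X n m => tmul F M (I.π.obj X) n m)
    (fun X n n' m => tmul_add_left (N := F) (M := M) (I.π.obj X) n n' m)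
    (fun X n m m' => tmul_add_right (N := F) (M := M) (I.π.obj X) n m m')
    (fun f n m => tmul_balanced (N := F) (M := M) (I.π.map f) n m)
  naturality M M' φ := by
    refine tensorObj_hom_ext (N := I.πStarOp.obj F) (M := I.πStar.obj M) fun X n m => ?_
    have e (M) (X : C) (n) (m : M.obj.obj (I.π.obj X)) := tensorLift_tmul (N := I.πStarOp.obj F)
      (M := I.πStar.obj M) (A := tensorObj F M)
      (fun X n m => tmul F M (I.π.obj X) n m)
      (fun X n n' m => tmul_add_left (N := F) (M := M) (I.π.obj X) n n' m)
      (fun X n m m' => tmul_add_right (N := F) (M := M) (I.π.obj X) n m m')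
      (fun f n m => tmul_balanced (N := F) (M := M) (I.π.map f) n m) X n m
    have e1 := tensorMap_tmul (𝟙 (I.πStarOp.obj F)) (I.πStar.map φ) X n m
    have e2 := tensorMap_tmul (𝟙 F) φ (I.π.obj X) n m
    refine (congrArg _ e1).trans ((e M' X n _).trans (Eq.trans ?_ (congrArg (tensorMap (𝟙 F) φ) (e M X n m)).symm))
    exact e2.symm

/-- The comparison homomorphism `Tor_i^C(F ∘ π, F' ∘ π) ⟶ Tor_i^{C/I}(F, F')`. For projective
resolutions `P` of `F' ∘ π` and `Q` of `F'` it is induced on homology by the composite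
`(F ∘ π) ⊗_C P ⟶ (F ∘ π) ⊗_C (Q ∘ π) ⟶ F ⊗_{C/I} Q`, where the first morphism comes from a
morphism `P ⟶ Q ∘ π` over the identity of `F' ∘ π`. -/
def torComparison (F : CMod I.Quotᵒᵖ) (F' : CMod I.Quot) (i : ℕ) :
    (Tor i (I.πStarOp.obj F)).obj (I.πStar.obj F') ⟶ (Tor i F).obj F' :=
  ((projectiveResolution (I.πStar.obj F')).isoLeftDerivedObj
      (tensor.obj (I.πStarOp.obj F)) i).hom ≫
    (HomologicalComplex.homologyFunctor AddCommGrpCat.{u} (ComplexShape.down ℕ) i).map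
      (((tensor.obj (I.πStarOp.obj F)).mapHomologicalComplex _).map
          (resolutionLift I.πStar (projectiveResolution (I.πStar.obj F'))
            (projectiveResolution F')) ≫
        (NatTrans.mapHomologicalComplex (I.tensorComparison F) _).app
          (projectiveResolution F').complex) ≫
    ((projectiveResolution F').isoLeftDerivedObj (tensor.obj F) i).inv

end CatIdeal

end Comparison


section Duality

variable (R : Type u) [CommRing R]

section

variable {C : Type u} [Category.{u} C] [Preadditive C] [Linear R C]

/-- The `R`-module structure on the values of a module over an `R`-linear category. -/
@[reducible]
def rModule (M : CMod C) (X : C) : Module R (M.obj.obj X) where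
  smul r m := M.obj.map (r • 𝟙 X) m
  one_smul m := by
    change M.obj.map ((1 : R) • 𝟙 X) m = m
    rw [one_smul, CategoryTheory.Functor.map_id]; rfl
  mul_smul r s m := by
    change M.obj.map ((r * s) • 𝟙 X) m = M.obj.map (r • 𝟙 X) (M.obj.map (s • 𝟙 X) m)
    rw [← AddCommGrpCat.comp_apply, ← Functor.map_comp]
    congr 2
    simp [mul_smul, smul_comm r s]
  smul_zero r := map_zero (M.obj.map (r • 𝟙 X)).hom
  smul_add r := map_add (M.obj.map (r • 𝟙 X)).hom
  add_smul r s m := by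
    change M.obj.map ((r + s) • 𝟙 X) m = M.obj.map (r • 𝟙 X) m + M.obj.map (s • 𝟙 X) m
    rw [add_smul, Functor.map_add]; rfl
  zero_smul m := by
    change M.obj.map ((0 : R) • 𝟙 X) m = 0
    rw [zero_smul, Functor.map_zero]; rfl

/-- A module over an `R`-linear category as a functor to `R`-modules. -/
def toModuleCat : CMod C ⥤ (C ⥤ ModuleCat.{u} R) where
  obj M :=
    { obj := fun X => letI := rModule R M X; ModuleCat.of R (M.obj.obj X)
      map := fun {X Y} f =>
        letI := rModule R M X
        letI := rModule R M Y
        ModuleCat.ofHom (X := M.obj.obj X) (Y := M.obj.obj Y)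
          { (M.obj.map f).hom with
            map_smul' := fun r m => by
              change M.obj.map f (M.obj.map (r • 𝟙 X) m) = M.obj.map (r • 𝟙 Y) (M.obj.map f m)
              rw [← AddCommGrpCat.comp_apply, ← AddCommGrpCat.comp_apply, ← Functor.map_comp,
                ← Functor.map_comp]
              simp }
      map_id := fun X => by
        exact ConcreteCategory.hom_ext _ _ fun m => ConcreteCategory.congr_hom (M.obj.map_id X) m
      map_comp := fun f g => by
        exact ConcreteCategory.hom_ext _ _ fun m => ConcreteCategory.congr_hom (M.obj.map_comp f g) m }
  map {M N} φ :=
    { app := fun X =>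
        letI := rModule R M X
        letI := rModule R N X
        ModuleCat.ofHom (X := M.obj.obj X) (Y := N.obj.obj X)
          { (φ.hom.app X).hom with
            map_smul' := fun r m => hom_app_map φ (r • 𝟙 X) m }
      naturality := fun X Y f => by
        exact ConcreteCategory.hom_ext _ _ fun m => hom_app_map φ f m }

instance (M : CMod C) : ((toModuleCat R).obj M).Additive where
  map_add {X Y f g} := by
    apply ModuleCat.hom_ext
    exact LinearMap.ext fun m =>
      ConcreteCategory.congr_hom (M.obj.map_add (f := f) (g := g)) m

/-- The functor `M ↦ Hom_R(M(-), E)` from `Mod(C)` to `Mod(Cᵒᵖ)`. -/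
def dualFunctor (E : ModuleCat.{u} R) : (CMod C)ᵒᵖ ⥤ CMod Cᵒᵖ where
  obj M := ⟨((toModuleCat R).obj M.unop).op ⋙ preadditiveYoneda.obj E, 
    (inferInstance : (((toModuleCat R).obj M.unop).op ⋙ preadditiveYoneda.obj E).Additive)⟩
  map {M N} φ := ObjectProperty.homMk
    (Functor.whiskerRight (NatTrans.op ((toModuleCat R).map φ.unop)) (preadditiveYoneda.obj E))

end

/-- `E` is an injective envelope of the `R`-module `S`: it is injective and an essential extension
of `S`. -/
def IsInjectiveEnvelope (S E : Type u) [AddCommGroup S] [Module R S] [AddCommGroup E]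
    [Module R E] : Prop :=
  Module.Injective R E ∧ ∃ ι : S →ₗ[R] E, Function.Injective ι ∧
    ∀ N : Submodule R E, N ⊓ LinearMap.range ι = ⊥ → N = ⊥

/-- The `R`-linear category `C` is Hom-finite, and the functor `M ↦ Hom_R(M(-), E)`, with `E` the
injective envelope of `R/rad(R)`, induces a duality between `mod(C)` and `mod(Cᵒᵖ)`. -/
structure IsDualizing (C : Type u) [Category.{u} C] [Preadditive C] [Linear R C] : Prop where
  finite_hom (X Y : C) : Module.Finite R (X ⟶ Y)
  duality : ∃ E : ModuleCat.{u} R, IsInjectiveEnvelope R (R ⧸ Ring.jacobson R) E ∧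
    ∃ h : ∀ M : CMod C, isFP C M → isFP Cᵒᵖ ((dualFunctor R E).obj (op M)),
      ((isFP Cᵒᵖ).lift ((isFP C).ι.op ⋙ dualFunctor R E)
        fun M => h _ M.unop.property).IsEquivalence

variable {R}

lemma IsDualizing.isClosedUnderKernels {C : Type u} [Category.{u} C] [Preadditive C]
    [Linear R C] [HasZeroObject C] [HasBinaryBiproducts C] (hC : IsDualizing R C) :
    (isFP C).IsClosedUnderKernels := by
  obtain ⟨-, E, -, h, hD⟩ := hC
  have h1 : HasCokernels (FPMod Cᵒᵖ) := inferInstance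
  have h2 : HasCoequalizers (FPMod Cᵒᵖ) := Preadditive.hasCoequalizers_of_hasCokernels
  have h3 : HasCoequalizers (FPMod C)ᵒᵖ := 
    Adjunction.hasColimitsOfShape_of_equivalence ((isFP Cᵒᵖ).lift ((isFP C).ι.op ⋙ dualFunctor R E)
        fun M => h _ M.unop.property)
  have h4 : HasColimitsOfShape WalkingParallelPairᵒᵖ (FPMod C)ᵒᵖ :=
    hasColimitsOfShape_of_equivalence walkingParallelPairOpEquiv
  have h5 : HasEqualizers (FPMod C) := hasLimitsOfShape_of_hasColimitsOfShape_op
  have h6 : HasKernels (FPMod C) := inferInstance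
  exact isClosedUnderKernels_of_hasKernels

end Duality


section Idempotent

variable {C : Type u} [Category.{u} C] [Preadditive C]

/-- `I` is `k`-idempotent: the homomorphisms `Ext^i(F, F') ⟶ Ext^i(F ∘ π, F' ∘ π)` induced by the
exact functor `π_* : Mod(C/I) ⥤ Mod(C)` are bijective for `0 ≤ i ≤ k`. -/
def CatIdeal.IsKIdempotent (I : CatIdeal C) (k : ℕ) : Prop :=
  ∀ i : ℕ, i ≤ k → ∀ F F' : CMod I.Quot, Function.Bijective (I.πStar.mapExtAddHom F F' i)

end Idempotent


end
end KIdem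

/-! The conditions are compared through the groups `Ext^i(π_* rep X, π_* F)` over `C` for `1 ≤ i ≤
k`, with `F` ranging over various classes of `C/I`-modules. Since `π` is full and bijective on
objects, the exact functor `π_*` is fully faithful. It is then bijective on `Ext^i` up to degree `k`
exactly when the representables, which are projective over `C/I`, have no Ext against `π_* F` after
restriction. So (a) is vanishing for all `F`, (b) and (c) for finitely presented `F`, and (d) for
injective objects of mod(C/I) (`isKIdempotent_iff`, `PropertyA.mapExt_πStarFP_bijective_iff`,
`isZero_EXT_iff`).

Tor is brought in by the adjunction `Hom(N ⊗ M, A) ≃ Hom(M, Hom_ℤ(N, A))`, where `A` runs over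
injective abelian groups, which detect exactness. By `isZero_TOR_iff`, (g) is vanishing for the
cofree modules `F = cofree Y A`. Every module embeds in a product of these, and dimension shifting
gives (g) ⇒ (a).

Besides providing kernels in mod(C), the duality serves (d) ⇒ (g). It makes `C(-, Y)/I(-, Y)` the
dual of `π_* M` for some finitely presented `M`. Such `M` are injective in mod(C/I), and every
object of mod(C/I) embeds in one, so (d) spreads to all finitely presented `F`. For finitely
presented `G`, vanishing of `Ext^i(G, N)` is exactness of `N X ⟶ N Y ⟶ N Z` for a pair `X ⟶ Y ⟶ Z`
depending only on `G` and `i` (`exists_ext_iff_exact`), and this passes from `N` to `Hom_ℤ(Hom_R(N,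
E), A)`. For `N = π_* M` the double dual is `π_* (cofree Y A)`.

For (e), dualizing ψ gives the comparison of `Hom(Q, J)` with `Hom(P, π_* J)` for `J = Hom_ℤ(F, A)`,
which (a) makes bijective on cohomology (`resolutionComparison_bijective`). Conversely, (e) with `F
= Hom(-, Y)`, whose Tor over `C/I` vanishes, gives (f), and (g) is a special case of (f). -/

namespace KIdem

noncomputable section

/-! ### Abelian categories: testing with injectives, vanishing of Ext, exact functors -/

section Abelian

open CategoryTheory.Abelian

variable {A : Type*} [Category* A] [Abelian A]

/-- Embed the cokernel of `S.f` in an injective `J`. The resulting map `X₂ ⟶ J` kills `S.f`, hence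
factors through `S.g` and vanishes on its kernel, which is exactness. -/
lemma exact_iff_forall_injective [EnoughInjectives A] (S : ShortComplex A) :
    S.Exact ↔ ∀ (J : A) [Injective J] (f : S.X₂ ⟶ J), S.f ≫ f = 0 →
      ∃ h : S.X₃ ⟶ J, S.g ≫ h = f := by
  refine ⟨fun hS J _ f hf => ⟨hS.descToInjective f hf, hS.comp_descToInjective f hf⟩, fun H => ?_⟩
  rw [S.exact_iff_kernel_ι_comp_cokernel_π_zero]
  obtain ⟨h, hh⟩ := H _ (cokernel.π S.f ≫ Injective.ι _) (by simp)
  rw [← cancel_mono (Injective.ι (cokernel S.f)), Category.assoc, ← hh, kernel.condition_assoc,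
    zero_comp, zero_comp]

lemma isIso_iff_forall_injective [EnoughInjectives A] {X Y : A} (φ : X ⟶ Y)
    (h₁ : ∀ (J : A) [Injective J] (f : X ⟶ J), ∃ g : Y ⟶ J, φ ≫ g = f)
    (h₂ : ∀ (J : A) [Injective J] (g : Y ⟶ J), φ ≫ g = 0 → g = 0) : IsIso φ := by
  have : Mono φ := by
    obtain ⟨g, hg⟩ := h₁ _ (Injective.ι X)
    have : Mono (φ ≫ g) := by rw [hg]; infer_instance
    exact mono_of_mono φ g
  have : Epi φ := by
    refine Preadditive.epi_of_cancel_zero _ fun {Z} g hg => ?_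
    rw [← cancel_mono (Injective.ι Z), zero_comp]
    exact h₂ _ _ (by rw [← Category.assoc, hg, zero_comp])
  exact isIso_of_mono_of_epi φ

/-- A morphism of short complexes is an isomorphism on homology if it becomes an isomorphism
on cohomology after applying `Hom(-, J)` for all injective objects `J`. -/
lemma isIso_homologyMap_of_forall_injective [EnoughInjectives A] {S T : ShortComplex A} (φ : S ⟶ T)
    (h₁ : ∀ (J : A) [Injective J] (f : S.X₂ ⟶ J), S.f ≫ f = 0 →
      ∃ (g : T.X₂ ⟶ J) (h : S.X₃ ⟶ J), T.f ≫ g = 0 ∧ φ.τ₂ ≫ g = f + S.g ≫ h)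
    (h₂ : ∀ (J : A) [Injective J] (g : T.X₂ ⟶ J) (h : S.X₃ ⟶ J), T.f ≫ g = 0 →
      φ.τ₂ ≫ g = S.g ≫ h → ∃ h' : T.X₃ ⟶ J, T.g ≫ h' = g) :
    IsIso (ShortComplex.homologyMap φ) := by
  apply isIso_iff_forall_injective
  · intro J _ f
    -- `homologyι` embeds homology in the opcycles, so `f` extends to the opcycles, that is, to a
    -- cocycle `S.X₂ ⟶ J`.
    let f' := Injective.factorThru f S.homologyι
    have hf' : S.homologyι ≫ f' = f := Injective.comp_factorThru _ _
    obtain ⟨g, h, hg, e⟩ := h₁ J (S.pOpcycles ≫ f') (by simp)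
    refine ⟨T.homologyι ≫ T.descOpcycles g hg, ?_⟩
    have e' : ShortComplex.opcyclesMap φ ≫ T.descOpcycles g hg = f' + S.fromOpcycles ≫ h := by
      rw [← cancel_epi S.pOpcycles]
      simp [e]
    rw [ShortComplex.homologyι_naturality_assoc, e', Preadditive.comp_add, hf']
    simp
  · intro J _ f hf
    let f' := Injective.factorThru f T.homologyι
    have hf' : T.homologyι ≫ f' = f := Injective.comp_factorThru _ _
    rw [← hf', ShortComplex.homologyι_naturality_assoc] at hf
    -- Homology is the kernel of `fromOpcycles`; a map to `J` that kills it is a coboundary because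
    -- `J` is injective.
    have ex : (ShortComplex.mk S.homologyι S.fromOpcycles (by simp)).Exact :=
      ShortComplex.exact_of_f_is_kernel _ S.homologyIsKernel
    have hh := ex.comp_descToInjective _ hf
    obtain ⟨h', hh'⟩ := h₂ J (T.pOpcycles ≫ f') (ex.descToInjective _ hf) (by simp) (by
      have := congrArg (fun t => S.pOpcycles ≫ t) hh
      simpa using this.symm)
    have : f' = T.fromOpcycles ≫ h' := by
      rw [← cancel_epi T.pOpcycles]
      simp [hh']
    rw [← hf', this]
    simp

section Ext

variable [HasExt.{u} A]

lemma subsingleton_ext_of_iso {X X' Y Y' : A} (e : X ≅ X') (e' : Y ≅ Y') {i : ℕ}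
    [Subsingleton (Ext.{u} X Y i)] : Subsingleton (Ext.{u} X' Y' i) := by
  refine subsingleton_of_forall_eq 0 fun x => ?_
  have h : (Ext.mk₀ e.hom).comp (x.comp (Ext.mk₀ e'.inv) (add_zero i)) (zero_add i) = 0 :=
    Subsingleton.elim _ _
  have := congrArg (fun t => (Ext.mk₀ e.inv).comp (t.comp (Ext.mk₀ e'.hom) (add_zero i))
    (zero_add i)) h
  simpa using this

variable {X Y : A}

/-- Expresses Ext-vanishing as a factorization property of morphisms, a form that can be moved
across the tensor-hom adjunction. -/
lemma subsingleton_ext_iff_of_projectiveResolution (P : ProjectiveResolution X) (n : ℕ) :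
    Subsingleton (Ext.{u} X Y (n + 1)) ↔ ∀ f : P.complex.X (n + 1) ⟶ Y,
      P.complex.d (n + 2) (n + 1) ≫ f = 0 → ∃ g, P.complex.d (n + 1) n ≫ g = f := by
  constructor
  · intro h f hf
    exact (P.extMk_eq_zero_iff f (n + 2) rfl hf n rfl).1 (Subsingleton.elim _ _)
  · intro h
    refine subsingleton_of_forall_eq 0 fun x => ?_
    obtain ⟨f, hf, rfl⟩ := P.extMk_surjective x (n + 2) rfl
    exact (P.extMk_eq_zero_iff f (n + 2) rfl hf n rfl).2 (h f hf)

lemma subsingleton_ext_iff_of_injectiveResolution (J : InjectiveResolution Y) (n : ℕ) :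
    Subsingleton (Ext.{u} X Y (n + 1)) ↔ ∀ f : X ⟶ J.cocomplex.X (n + 1),
      f ≫ J.cocomplex.d (n + 1) (n + 2) = 0 → ∃ g, g ≫ J.cocomplex.d n (n + 1) = f := by
  constructor
  · intro h f hf
    exact (J.extMk_eq_zero_iff f (n + 2) rfl hf n rfl).1 (Subsingleton.elim _ _)
  · intro h
    refine subsingleton_of_forall_eq 0 fun x => ?_
    obtain ⟨f, hf, rfl⟩ := J.extMk_surjective x (n + 2) rfl
    exact (J.extMk_eq_zero_iff f (n + 2) rfl hf n rfl).2 (h f hf)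

/-- One injective resolution of `Y` serves all the `M j`, so the factorizations on the summands
glue; exactness of coproducts is not needed. -/
lemma subsingleton_ext_of_isColimit_cofan [EnoughInjectives A] {ι : Type*} {M : ι → A}
    (c : Cofan M) (hc : IsColimit c) (n : ℕ) [∀ j, Subsingleton (Ext.{u} (M j) Y (n + 1))] :
    Subsingleton (Ext.{u} c.pt Y (n + 1)) := by
  let J := InjectiveResolution.of Y
  rw [subsingleton_ext_iff_of_injectiveResolution J]
  intro f hf
  choose g hg using fun j => (subsingleton_ext_iff_of_injectiveResolution (X := M j) J n).1
    inferInstance (c.inj j ≫ f) (by rw [Category.assoc, hf, comp_zero])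
  refine ⟨Cofan.IsColimit.desc hc g, Cofan.IsColimit.hom_ext hc _ _ fun j => ?_⟩
  rw [← hg, ← Category.assoc, Cofan.IsColimit.fac]

lemma subsingleton_ext_of_isLimit_fan [EnoughProjectives A] {ι : Type*} {M : ι → A}
    (c : Fan M) (hc : IsLimit c) (n : ℕ) [∀ j, Subsingleton (Ext.{u} X (M j) (n + 1))] :
    Subsingleton (Ext.{u} X c.pt (n + 1)) := by
  let P := ProjectiveResolution.of X
  rw [subsingleton_ext_iff_of_projectiveResolution P]
  intro f hf
  choose g hg using fun j => (subsingleton_ext_iff_of_projectiveResolution (Y := M j) P n).1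
    inferInstance (f ≫ c.proj j) (by rw [← Category.assoc, hf, zero_comp])
  refine ⟨Fan.IsLimit.lift hc g, Fan.IsLimit.hom_ext hc _ _ fun j => ?_⟩
  rw [← hg, Category.assoc, Fan.IsLimit.fac]

/-- Dimension shifting in the second variable. -/
lemma subsingleton_ext_of_shortExact {S : ShortComplex A} (hS : S.ShortExact) {k : ℕ}
    (h₀ : ∀ f : X ⟶ S.X₃, ∃ g : X ⟶ S.X₂, g ≫ S.g = f)
    (h₂ : ∀ i, 1 ≤ i → i ≤ k → Subsingleton (Ext.{u} X S.X₂ i))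
    (h₃ : ∀ i, 1 ≤ i → i + 1 ≤ k → Subsingleton (Ext.{u} X S.X₃ i)) (i : ℕ) (hi : 1 ≤ i)
    (hik : i ≤ k) : Subsingleton (Ext.{u} X S.X₁ i) := by
  obtain ⟨i, rfl⟩ := Nat.exists_eq_add_of_le' hi
  refine subsingleton_of_forall_eq 0 fun x => ?_
  have := h₂ _ hi hik
  obtain ⟨y, rfl⟩ := Ext.covariant_sequence_exact₁ X hS x (Subsingleton.elim _ _) rfl
  -- In degree 1 the class comes from a morphism `X ⟶ S.X₃`, which lifts to `S.X₂` by `h₀` and is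
  -- therefore killed by the connecting map. In higher degrees `h₃` applies one degree lower.
  rcases i with _ | i
  · obtain ⟨f, rfl⟩ := (Ext.mk₀_bijective _ _).2 y
    obtain ⟨g, rfl⟩ := h₀ f
    rw [← Ext.mk₀_comp_mk₀_assoc, ShortComplex.ShortExact.comp_extClass, Ext.comp_zero]
  · have := h₃ (i + 1) (by lia) hik
    rw [Subsingleton.elim y 0, Ext.zero_comp]

end Ext

variable {B : Type*} [Category* B] [Abelian B] (L : A ⥤ B) [L.Additive]
  [PreservesFiniteLimits L] [PreservesFiniteColimits L]

section MapExt

attribute [local simp] Ext.mapExactFunctor_comp Ext.mapExactFunctor_mk₀ Ext.mapExactFunctor_extClass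

attribute [local instance] Ext.subsingleton_of_projective in
/-- A fully faithful exact functor `L` induces bijections on `Ext^i` for `i ≤ k` if every
object is a quotient of a projective object `P` with `Ext^i(L P, L Y) = 0` for `1 ≤ i ≤ k`. -/
lemma mapExt_bijective_of_projective_cover [L.Full] [L.Faithful] [HasExt.{u} A]
    [HasExt.{u} B] (Y : A) (k : ℕ)
    (h : ∀ X : A, ∃ (P : A) (p : P ⟶ X), Projective P ∧ Epi p ∧
      ∀ i, 1 ≤ i → i ≤ k → Subsingleton (Ext.{u} (L.obj P) (L.obj Y) i)) (n : ℕ) (hn : n ≤ k)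
    (X : A) : Function.Bijective (L.mapExtAddHom X Y n) := by
  induction n generalizing X with
  | zero => simpa [Ext.mapExactFunctor₀] using ⟨L.map_injective, L.map_surjective⟩
  | succ n ih =>
    -- As Ext in degree `n + 1` vanishes on `P` and on `L P`, both sides are cokernels of maps
    -- between groups in degree `n`, where the induction hypothesis applies.
    obtain ⟨P, p, hP, hp, hL⟩ := h X
    let S := ShortComplex.mk _ _ (kernel.condition p)
    have hS : S.ShortExact := { exact := ShortComplex.exact_kernel p }
    have := hL (n + 1) (by lia) hn
    exact AddMonoidHom.bijective_of_surjective_of_bijective_of_right_exact _ _ _ _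
      (L.mapExtAddHom S.X₂ Y n) (L.mapExtAddHom S.X₁ Y n) (L.mapExtAddHom S.X₃ Y (n + 1))
      (by cat_disch) (by cat_disch)
      ((ShortComplex.ab_exact_iff_function_exact _).1
        (Ext.contravariant_sequence_exact₁' hS Y n (n + 1) (add_comm 1 n)))
      ((ShortComplex.ab_exact_iff_function_exact _).1
        (Ext.contravariant_sequence_exact₁' (hS.map L) (L.obj Y) n (n + 1) (add_comm 1 n)))
      (ih (by lia) _).surjective (ih (by lia) _)
      (fun x₃ ↦ Ext.contravariant_sequence_exact₃ hS _ x₃ (Subsingleton.elim _ _) (add_comm 1 n))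
      (fun y₃ ↦ Ext.contravariant_sequence_exact₃ (hS.map L) _ y₃
        (this.elim _ _) (add_comm 1 n))

end MapExt

end Abelian

/-! ### Comparing projective resolutions along a fully faithful exact functor -/

section ResolutionComparison

open CategoryTheory.Abelian

variable {A : Type*} [Category* A] [Abelian A] [EnoughInjectives A]
  {B : Type*} [Category* B] [Abelian B] [HasExt.{u} B]
  (L : A ⥤ B) [L.Additive] [L.Full] [L.Faithful]
  [PreservesFiniteLimits L] [PreservesFiniteColimits L]
  {Z : A} (P : ProjectiveResolution (L.obj Z)) (Q : ProjectiveResolution Z)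
  (v : ∀ n, P.complex.X n ⟶ L.obj (Q.complex.X n))

/-- Suppose that `Ext^i(L Z, L J) = 0` for all injective `J` and `1 ≤ i ≤ k`. Then the morphism
`Hom(Q, J) ⟶ Hom(P, L J)` induced by a morphism `P ⟶ L Q` of resolutions is an isomorphism on
cohomology in degrees `≤ k` for all objects `J`. -/
lemma resolutionComparison_bijective
    (hd : ∀ n, v (n + 1) ≫ L.map (Q.complex.d (n + 1) n) = P.complex.d (n + 1) n ≫ v n)
    (hv : v 0 ≫ L.map (Q.π.f 0) = P.π.f 0) (k : ℕ)
    (hk : ∀ (J : A) [Injective J] (i : ℕ), 1 ≤ i → i ≤ k →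
      Subsingleton (Ext.{u} (L.obj Z) (L.obj J) i)) (n : ℕ) (hn : n ≤ k) (J : A) :
    (∀ f : P.complex.X n ⟶ L.obj J, P.complex.d (n + 1) n ≫ f = 0 →
      ∃ (g : Q.complex.X n ⟶ J) (h : P.complex.X (n - 1) ⟶ L.obj J),
        Q.complex.d (n + 1) n ≫ g = 0 ∧
        v n ≫ L.map g = f + P.complex.d n (n - 1) ≫ h) ∧
    (∀ (g : Q.complex.X n ⟶ J) (h : P.complex.X (n - 1) ⟶ L.obj J),
      Q.complex.d (n + 1) n ≫ g = 0 → v n ≫ L.map g = P.complex.d n (n - 1) ≫ h →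
      ∃ h', Q.complex.d n (n - 1) ≫ h' = g) := by
  obtain ⟨p, hpe, hp⟩ : ∃ p : P.complex.X 0 ⟶ L.obj Z, Epi p ∧ p = P.π.f 0 :=
    ⟨P.π.f 0, inferInstanceAs (Epi (P.π.f 0)), rfl⟩
  obtain ⟨q, hq⟩ : ∃ q : Q.complex.X 0 ⟶ Z, q = Q.π.f 0 := ⟨Q.π.f 0, rfl⟩
  replace hv : v 0 ≫ L.map q = p := by rw [hp, hq]; exact hv
  have hq' : Q.complex.d 1 0 ≫ q = 0 := by rw [hq]; exact Q.complex_d_comp_π_f_zero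
  -- `J` varies because the step passes to the cokernel of an embedding of `J` in an injective. In
  -- degree 0, `n - 1` is again 0 and `d 0 0 = 0`, so the coboundary terms vanish.
  induction n generalizing J with
  | zero =>
    constructor
    · intro f hf
      obtain ⟨f', hf'⟩ : ∃ f', p ≫ f' = f := by
        rw [hp]
        exact ⟨P.exact₀.desc f hf, P.exact₀.g_desc f hf⟩
      refine ⟨q ≫ L.preimage f', 0, ?_, ?_⟩
      · rw [← Category.assoc, hq', zero_comp]
      · rw [comp_zero, add_zero, L.map_comp, ← Category.assoc, hv, L.map_preimage, hf']
    · intro g h hg e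
      obtain ⟨g', hg'⟩ : ∃ g', q ≫ g' = g := by
        rw [hq]
        exact ⟨Q.exact₀.desc g hg, Q.exact₀.g_desc g hg⟩
      rw [P.complex.shape 0 _ (by simp), zero_comp, ← hg', L.map_comp, ← Category.assoc, hv] at e
      have : L.map g' = 0 := by
        rw [← cancel_epi p, e, comp_zero]
      have : g' = 0 := L.map_injective (by rw [this, L.map_zero])
      exact ⟨0, by rw [comp_zero, ← hg', this, comp_zero]⟩
  | succ n ih =>
    let a : J ⟶ Injective.under J := Injective.ι J
    let b := cokernel.π a
    have w : a ≫ b = 0 := cokernel.condition a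
    have ex : (ShortComplex.mk a b w).Exact := ShortComplex.exact_cokernel a
    have exL : (ShortComplex.mk (L.map a) (L.map b) (by rw [← L.map_comp, w, L.map_zero])).Exact :=
      ex.map L
    have : Epi (L.map b) := L.map_epi b
    have : Mono (L.map a) := L.map_mono a
    have lift₁ {T : A} (x : T ⟶ Injective.under J) (hx : x ≫ b = 0) : ∃ y, y ≫ a = x :=
      ⟨ex.lift x hx, ex.lift_f x hx⟩
    have lift₂ {T : B} (x : T ⟶ L.obj (Injective.under J)) (hx : x ≫ L.map b = 0) :
        ∃ y, y ≫ L.map a = x := ⟨exL.lift x hx, exL.lift_f x hx⟩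
    constructor
    · intro f hf
      -- Surjectivity: by `hk`, the cocycle `f` becomes a coboundary `d ≫ h` in `L` of the
      -- injective. Then `h ≫ L.map b` is a cocycle of degree `n` with values in `L` of the
      -- cokernel.
      have h1 := (subsingleton_ext_iff_of_projectiveResolution P n).1
        (hk (Injective.under J) (n + 1) (by lia) hn) (f ≫ L.map a)
        (by rw [← Category.assoc, hf, zero_comp])
      obtain ⟨h, hh⟩ := h1
      obtain ⟨g', e, hg', he⟩ := (ih (by lia) (cokernel a)).1 (h ≫ L.map b) (by
        rw [← Category.assoc, hh, Category.assoc, ← L.map_comp, w, L.map_zero, comp_zero])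
      -- Projectivity lifts the class found in the cokernel back to the injective; the differential
      -- of the lift lands in `J`.
      let g'' : Q.complex.X n ⟶ Injective.under J := Projective.factorThru g' b
      have hg'' : g'' ≫ b = g' := Projective.factorThru_comp g' b
      obtain ⟨g, hg⟩ := lift₁ (Q.complex.d (n + 1) n ≫ g'')
        (by rw [Category.assoc, hg'', hg'])
      let e' := Projective.factorThru e (L.map b)
      have he' : e' ≫ L.map b = e := Projective.factorThru_comp e (L.map b)
      obtain ⟨r, hr⟩ := lift₂ (v n ≫ L.map g'' - h - P.complex.d n (n - 1) ≫ e') (by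
        rw [Preadditive.sub_comp, Preadditive.sub_comp, Category.assoc, Category.assoc, he',
          ← L.map_comp, hg'', he]
        abel)
      refine ⟨g, r, ?_, ?_⟩
      · rw [← cancel_mono a, Category.assoc, hg, ← Category.assoc, Q.complex.d_comp_d, zero_comp,
          zero_comp]
      · rw [← cancel_mono (L.map a), Category.assoc, ← L.map_comp, hg, Preadditive.add_comp,
          ← hh, Category.assoc]
        change _ = _ + P.complex.d (n + 1) n ≫ r ≫ L.map a
        rw [hr, L.map_comp, ← Category.assoc, hd, Preadditive.comp_sub, Preadditive.comp_sub,
          ← Category.assoc (P.complex.d (n + 1) n) (P.complex.d n (n - 1)), P.complex.d_comp_d,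
          zero_comp, Category.assoc]
        abel
    · intro g h₀ hg e
      obtain ⟨h, e⟩ : ∃ h : P.complex.X n ⟶ L.obj J,
        v (n + 1) ≫ L.map g = P.complex.d (n + 1) n ≫ h := ⟨h₀, e⟩
      obtain ⟨m, hm⟩ : ∃ m, Q.complex.d (n + 1) n ≫ m = g ≫ a := by
        have := (Q.exact_succ n)
        refine ⟨this.descToInjective (g ≫ a) ?_, this.comp_descToInjective _ _⟩
        change Q.complex.d (n + 2) (n + 1) ≫ g ≫ a = 0
        rw [← Category.assoc, hg, zero_comp]
      -- Injectivity: `m` need not be compatible with `h`, but the defect is a cocycle, which a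
      -- cocycle `q` over `Q` corrects up to a coboundary. In the cokernel, `m - q` is then a
      -- cocycle that becomes a coboundary over `P`, hence is one over `Q`.
      obtain ⟨q, r, hq, hr⟩ := (ih (by lia) (Injective.under J)).1
        (v n ≫ L.map m - h ≫ L.map a) (by
          rw [Preadditive.comp_sub, ← Category.assoc, ← Category.assoc, ← hd, ← e, Category.assoc,
            Category.assoc, ← L.map_comp, ← L.map_comp, hm, sub_self])
      obtain ⟨h', hh'⟩ := (ih (by lia) (cokernel a)).2 ((m - q) ≫ b) (- r ≫ L.map b) (by
          rw [← Category.assoc, Preadditive.comp_sub, hm, hq, sub_zero, Category.assoc, w,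
            comp_zero]) (by
          rw [L.map_comp, ← Category.assoc, L.map_sub, Preadditive.comp_sub, hr]
          simp only [Preadditive.sub_comp, Preadditive.add_comp, Preadditive.comp_neg, Category.assoc]
          rw [← L.map_comp a b, w, L.map_zero, comp_zero]
          abel)
      let h'' := Projective.factorThru h' b
      have hh'' : h'' ≫ b = h' := Projective.factorThru_comp h' b
      obtain ⟨s, hs⟩ := lift₁ (m - q - Q.complex.d n (n - 1) ≫ h'') (by
        rw [Preadditive.sub_comp, Category.assoc, hh'', hh', sub_self])
      refine ⟨s, ?_⟩
      change Q.complex.d (n + 1) n ≫ s = g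
      rw [← cancel_mono a, Category.assoc, hs, Preadditive.comp_sub, Preadditive.comp_sub, hm, hq,
        ← Category.assoc, Q.complex.d_comp_d, zero_comp, sub_zero, sub_zero]

end ResolutionComparison

/-! ### The tensor-hom adjunction -/

section TensorHom

variable {C : Type u} [Category.{u} C] [Preadditive C]

/-- The functor `N ↦ Hom_ℤ(N(-), A)` from `Mod(Cᵒᵖ)` to `Mod(C)`. -/
def zdual (A : AddCommGrpCat.{u}) : (CMod Cᵒᵖ)ᵒᵖ ⥤ CMod C where
  obj N := ⟨N.unop.obj.rightOp ⋙ preadditiveYoneda.obj A, ⟨fun {X Y f g} => by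
    ext φ
    exact (congrArg (fun t => t ≫ (show N.unop.obj.obj (op X) ⟶ A from φ))
      (N.unop.obj.map_add (f := f.op) (g := g.op))).trans (Preadditive.add_comp _ _ _ _ _ _)⟩⟩
  map φ := ObjectProperty.homMk
    (Functor.whiskerRight (NatTrans.rightOp φ.unop.hom) (preadditiveYoneda.obj A))

variable {N : CMod Cᵒᵖ} {M M' : CMod C} {A : AddCommGrpCat.{u}}

/-- The morphism `N ⊗_C M ⟶ A` corresponding to a morphism `M ⟶ Hom_ℤ(N, A)`. -/
def tensorUncurry (g : M ⟶ (zdual A).obj (op N)) : tensorObj N M ⟶ A :=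
  tensorLift (fun X n m => (show N.obj.obj (op X) ⟶ A from g.hom.app X m) n)
    (fun X n n' m => map_add _ _ _)
    (fun X n m m' => by rw [map_add]; rfl)
    (fun {X Y} f n m => by rw [hom_app_map]; rfl)

lemma tensorUncurry_tmul (g : M ⟶ (zdual A).obj (op N)) (X : C) (n : N.obj.obj (op X))
    (m : M.obj.obj X) : tensorUncurry g (tmul N M X n m) =
      (show N.obj.obj (op X) ⟶ A from g.hom.app X m) n :=
  FreeAbelianGroup.lift_apply_of _ _

/-- The adjunction isomorphism `Hom(N ⊗_C M, A) ≃ Hom(M, Hom_ℤ(N, A))`. -/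
def tensorHomEquiv : (tensorObj N M ⟶ A) ≃+ (M ⟶ (zdual A).obj (op N)) where
  toFun f := ObjectProperty.homMk
    { app := fun X => AddCommGrpCat.ofHom (AddMonoidHom.mk'
        (fun m => (AddCommGrpCat.ofHom (AddMonoidHom.mk' (fun n => f (tmul N M X n m))
          (fun n n' => by rw [tmul_add_left, map_add])) : N.obj.obj (op X) ⟶ A))
        (fun m m' => by
          refine AddCommGrpCat.hom_ext (AddMonoidHom.ext fun n => ?_)
          change f (tmul N M X n (m + m')) = f (tmul N M X n m) + f (tmul N M X n m')
          rw [tmul_add_right, map_add]))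
      naturality := fun X Y g => by
        ext m
        refine AddCommGrpCat.hom_ext (AddMonoidHom.ext fun n => ?_)
        exact congrArg f (tmul_balanced g n m).symm }
  invFun g := tensorUncurry g
  left_inv f := tensorObj_hom_ext fun X n m => tensorUncurry_tmul _ X n m
  right_inv g := by
    ext X m
    exact AddCommGrpCat.hom_ext (AddMonoidHom.ext fun n => tensorUncurry_tmul g X n m)
  map_add' f g := rfl

lemma zdual_hom_ext {f g : M ⟶ (zdual A).obj (op N)}
    (h : ∀ X m n, (show N.obj.obj (op X) ⟶ A from f.hom.app X m) n =
      (show N.obj.obj (op X) ⟶ A from g.hom.app X m) n) : f = g := by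
  ext X m
  exact AddCommGrpCat.hom_ext (AddMonoidHom.ext fun n => h X m n)

lemma tensorHomEquiv_comp (ψ : M ⟶ M') (f : tensorObj N M' ⟶ A) :
    tensorHomEquiv (tensorMap (𝟙 N) ψ ≫ f) = ψ ≫ tensorHomEquiv f :=
  zdual_hom_ext fun X m n => congrArg f (tensorMap_tmul (𝟙 N) ψ X n m)

end TensorHom

/-! ### EXT and TOR in terms of Ext -/

section DerivedFunctors

open CategoryTheory.Abelian

lemma isZero_leftDerived_iff {A B : Type*} [Category* A] [Abelian A] [HasProjectiveResolutions A]
    [Category* B] [Abelian B] (F : A ⥤ B) [F.Additive] {M : A} (P : ProjectiveResolution M) (i : ℕ) :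
    IsZero ((F.leftDerived (i + 1)).obj M) ↔
      (ShortComplex.mk (F.map (P.complex.d (i + 2) (i + 1))) (F.map (P.complex.d (i + 1) i))
        (by rw [← F.map_comp, P.complex.d_comp_d, F.map_zero])).Exact := by
  refine (Iso.isZero_iff (P.isoLeftDerivedObj F (i + 1))).trans ?_
  refine (HomologicalComplex.exactAt_iff_isZero_homology _ _).symm.trans ?_
  exact HomologicalComplex.exactAt_iff' _ (i + 2) (i + 1) i (by simp) (by simp)

lemma isZero_rightDerived_iff {A B : Type*} [Category* A] [Abelian A] [HasInjectiveResolutions A]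
    [Category* B] [Abelian B] (F : A ⥤ B) [F.Additive] {M : A} (J : InjectiveResolution M) (i : ℕ) :
    IsZero ((F.rightDerived (i + 1)).obj M) ↔
      (ShortComplex.mk (F.map (J.cocomplex.d i (i + 1))) (F.map (J.cocomplex.d (i + 1) (i + 2)))
        (by rw [← F.map_comp, J.cocomplex.d_comp_d, F.map_zero])).Exact := by
  refine (Iso.isZero_iff (J.isoRightDerivedObj F (i + 1))).trans ?_
  refine (HomologicalComplex.exactAt_iff_isZero_homology _ _).symm.trans ?_
  exact HomologicalComplex.exactAt_iff' _ i (i + 1) (i + 2) (by simp) (by simp)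

variable {C : Type u} [Category.{u} C] [Preadditive C]

/-- Exactness of `N ⊗ P` is tested by maps to injective groups `A`. By adjunction these are maps
from the resolution `P` of `M` to `Hom_ℤ(N, A)`, which compute Ext. -/
lemma isZero_tor_iff (N : CMod Cᵒᵖ) (M : CMod C) (i : ℕ) :
    IsZero ((Tor (i + 1) N).obj M) ↔ ∀ A : AddCommGrpCat.{u}, Injective A →
      Subsingleton (Abelian.Ext.{u} M ((zdual A).obj (op N)) (i + 1)) := by
  let P := projectiveResolution M
  refine (isZero_leftDerived_iff (tensor.obj N) P i).trans ?_
  rw [exact_iff_forall_injective]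
  refine forall_congr' fun A => forall_congr' fun _ => ?_
  rw [subsingleton_ext_iff_of_projectiveResolution P]
  have key {X Y : CMod C} (ψ : X ⟶ Y) (f : tensorObj N Y ⟶ A) (g : tensorObj N X ⟶ A) :
      tensorMap (𝟙 N) ψ ≫ f = g ↔ ψ ≫ tensorHomEquiv f = tensorHomEquiv g := by
    rw [← tensorHomEquiv_comp, EmbeddingLike.apply_eq_iff_eq]
  constructor
  · intro h f hf
    obtain ⟨g, hg⟩ := h (tensorHomEquiv.symm f) ((key _ _ _).2 (by
      rw [AddEquiv.apply_symm_apply]; exact hf.trans (map_zero _).symm))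
    exact ⟨tensorHomEquiv g, ((key _ _ _).1 hg).trans (by simp)⟩
  · intro h f hf
    obtain ⟨g, hg⟩ := h (tensorHomEquiv f) (((key _ _ _).1 hf).trans (map_zero _))
    exact ⟨tensorHomEquiv.symm g, (key _ _ _).2 (by simpa using hg)⟩

namespace CatIdeal

variable (I : CatIdeal C)

lemma isZero_TOR_iff_tor (M : CMod C) (i : ℕ) :
    IsZero ((I.TOR (i + 1)).obj M) ↔
      ∀ Y : I.Quot, IsZero ((Tor (i + 1) (I.quotRight.obj Y)).obj M) := by
  let P := projectiveResolution M
  refine (isZero_leftDerived_iff I.tensorQuot P i).trans ?_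
  rw [exact_iff]
  refine forall_congr' fun Y => ?_
  refine Iff.trans ?_ (isZero_leftDerived_iff (tensor.obj (I.quotRight.obj Y)) P i).symm
  rw [ShortComplex.ab_exact_iff_function_exact]
  rfl

/-- Exactness in Mod(C/I) is pointwise, and the value at `X` of `homQuot` on an injective resolution
of `M` is the complex computing Ext out of `π_* rep X`. -/
lemma isZero_EXT_iff (M : CMod C) (i : ℕ) :
    IsZero ((I.EXT (i + 1)).obj M) ↔
      ∀ X : I.Quot, Subsingleton (Abelian.Ext.{u} (I.πStar.obj (rep X)) M (i + 1)) := by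
  let J := injectiveResolution M
  refine (isZero_rightDerived_iff I.homQuot J i).trans ?_
  rw [exact_iff]
  refine forall_congr' fun X => ?_
  rw [subsingleton_ext_iff_of_injectiveResolution J]
  constructor
  · intro h f hf
    exact (h f).1 hf
  · intro h f
    refine ⟨h f, ?_⟩
    rintro ⟨g, rfl⟩
    change ((show I.πStar.obj (rep X) ⟶ _ from g) ≫ J.cocomplex.d i (i + 1)) ≫ J.cocomplex.d (i + 1) (i + 2) = 0
    rw [Category.assoc, J.cocomplex.d_comp_d, comp_zero]

/-- `Hom_ℤ(C(-, Y)/I(-, Y), A)` is the restriction of the cofree module `Hom_ℤ(C/I(-, Y), A)`. -/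
def zdualQuotRight (A : AddCommGrpCat.{u}) (Y : I.Quot) :
    (zdual A).obj (Opposite.op (I.quotRight.obj Y)) ≅ I.πStar.obj (cofree Y A) :=
  (ObjectProperty.fullyFaithfulι _).preimageIso (NatIso.ofComponents (fun X =>
    AddEquiv.toAddCommGrpIso
      { toFun := fun f => (show (I.quotRight.obj Y).obj.obj (Opposite.op X) ⟶ A from f).hom
        invFun := fun f => AddCommGrpCat.ofHom f
        left_inv := fun _ => rfl
        right_inv := fun _ => rfl
        map_add' := fun _ _ => rfl }) fun _ => rfl)

/-- Since the `ℤ`-dual of `C(-, Y)/I(-, Y)` is restricted from `C/I`, TOR of a restricted module is,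
like EXT, governed by Ext between restricted modules. -/
lemma isZero_TOR_iff (M : CMod C) (i : ℕ) :
    IsZero ((I.TOR (i + 1)).obj M) ↔ ∀ (Y : I.Quot) (A : AddCommGrpCat.{u}), Injective A →
      Subsingleton (Abelian.Ext.{u} M (I.πStar.obj (cofree Y A)) (i + 1)) := by
  rw [isZero_TOR_iff_tor]
  refine forall_congr' fun Y => (isZero_tor_iff _ _ _).trans ?_
  refine forall_congr' fun A => forall_congr' fun _ => ⟨fun _ => ?_, fun _ => ?_⟩
  · exact subsingleton_ext_of_iso (i := i + 1) (Iso.refl M) (I.zdualQuotRight A Y)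
  · exact subsingleton_ext_of_iso (i := i + 1) (Iso.refl M) (I.zdualQuotRight A Y).symm

end CatIdeal

end DerivedFunctors

/-! ### The comparison map on Tor -/

section TorComparison

namespace CatIdeal

variable {C : Type u} [Category.{u} C] [Preadditive C] (I : CatIdeal C)

instance : I.πStar.Faithful where
  map_injective {M N φ ψ} h := by
    ext ⟨X⟩ m
    exact congrArg (fun t => t.hom.app X m) h

/-- As `π` is full and bijective on objects, naturality over `C/I` need only be checked on images of
morphisms of `C`. -/
instance : I.πStar.Full where
  map_surjective {M N} φ := by
    refine ⟨ObjectProperty.homMk { app := fun X => φ.hom.app X.as, naturality := ?_ }, rfl⟩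
    rintro ⟨X⟩ ⟨Y⟩ f
    obtain ⟨f, rfl⟩ := I.π.map_surjective (X := X) (Y := Y) f
    exact φ.hom.naturality f

/-- The adjunction isomorphism `Hom((F ∘ π) ⊗_C M, A) ≃ Hom(M, Hom_ℤ(F, A) ∘ π)`. -/
def tensorHomEquivRes {F : CMod I.Quotᵒᵖ} {M : CMod C} {A : AddCommGrpCat.{u}} :
    (tensorObj (I.πStarOp.obj F) M ⟶ A) ≃+ (M ⟶ I.πStar.obj ((zdual A).obj (Opposite.op F))) :=
  tensorHomEquiv

variable {F : CMod I.Quotᵒᵖ} {A : AddCommGrpCat.{u}}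

lemma tensorHomEquivRes_comp {M M' : CMod C} (ψ : M ⟶ M')
    (f : tensorObj (I.πStarOp.obj F) M' ⟶ A) :
    I.tensorHomEquivRes (tensorMap (𝟙 _) ψ ≫ f) = ψ ≫ I.tensorHomEquivRes f :=
  tensorHomEquiv_comp ψ f

lemma tensorComparison_app_tmul (M : CMod I.Quot) (X : C) (n : F.obj.obj (Opposite.op (I.π.obj X)))
    (m : M.obj.obj (I.π.obj X)) :
    (I.tensorComparison F).app M (tmul (I.πStarOp.obj F) (I.πStar.obj M) X n m) =
      tmul F M (I.π.obj X) n m :=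
  FreeAbelianGroup.lift_apply_of _ _

/-- Under the two adjunctions, precomposition with `x ⊗ y ↦ x ⊗ y` becomes the action of `π_*` on
morphisms. -/
lemma tensorHomEquivRes_tensorComparison {M : CMod I.Quot} (g : tensorObj F M ⟶ A) :
    I.tensorHomEquivRes ((I.tensorComparison F).app M ≫ g) = I.πStar.map (tensorHomEquiv g) :=
  zdual_hom_ext (N := I.πStarOp.obj F) (M := I.πStar.obj M) fun X m n =>
    congrArg g (I.tensorComparison_app_tmul M X n m)

/-- Dualizing into an injective group `J` turns ψ into the comparison on cohomology with
coefficients in `Hom_ℤ(F, J)`. That module need not be injective, which is why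
`resolutionComparison_bijective` allows all coefficient objects while assuming Ext-vanishing only
for injective ones. -/
lemma isIso_torComparison (F : CMod I.Quotᵒᵖ) (F' : CMod I.Quot) (k : ℕ)
    (hk : ∀ (J : CMod I.Quot) [Injective J] (i : ℕ), 1 ≤ i → i ≤ k →
      Subsingleton (Abelian.Ext.{u} (I.πStar.obj F') (I.πStar.obj J) i)) (i : ℕ)
    (hik : i + 1 ≤ k) : IsIso (I.torComparison F F' (i + 1)) := by
  let P := projectiveResolution (I.πStar.obj F')
  let Q := projectiveResolution F'
  let v (n : ℕ) : P.complex.X n ⟶ I.πStar.obj (Q.complex.X n) := (resolutionLift I.πStar P Q).f n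
  let f : ((tensor.obj (I.πStarOp.obj F)).mapHomologicalComplex _).obj P.complex ⟶
      ((tensor.obj F).mapHomologicalComplex _).obj Q.complex :=
    ((tensor.obj (I.πStarOp.obj F)).mapHomologicalComplex _).map (resolutionLift I.πStar P Q) ≫
      (NatTrans.mapHomologicalComplex (I.tensorComparison F) _).app Q.complex
  have comp := resolutionComparison_bijective I.πStar P Q v
    (fun n => (resolutionLift I.πStar P Q).comm _ _) (resolutionLift_commutes I.πStar P Q) k hk
    (i + 1) hik
  have hq : QuasiIsoAt f (i + 1) := by
    rw [quasiIsoAt_iff' f (i + 2) (i + 1) i (by simp) (by simp), ShortComplex.quasiIso_iff]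
    have key {A : AddCommGrpCat.{u}} {n : ℕ} (g : tensorObj F (Q.complex.X n) ⟶ A) :
      I.tensorHomEquivRes (f.f n ≫ g) = v n ≫ I.πStar.map (tensorHomEquiv g) :=
      (congrArg I.tensorHomEquivRes (Category.assoc _ _ _)).trans
        ((I.tensorHomEquivRes_comp (v n) _).trans
          (congrArg (v n ≫ ·) (I.tensorHomEquivRes_tensorComparison g)))
    apply isIso_homologyMap_of_forall_injective
    · intro J _ g hg
      obtain ⟨a, b, ha, hab⟩ := (comp ((zdual J).obj (Opposite.op F))).1 (I.tensorHomEquivRes g)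
        ((I.tensorHomEquivRes_comp _ _).symm.trans ((congrArg _ hg).trans (map_zero _)))
      refine ⟨tensorHomEquiv.symm a, I.tensorHomEquivRes.symm b, ?_, ?_⟩
      · apply tensorHomEquiv.injective
        exact (tensorHomEquiv_comp _ _).trans ((congrArg _ (AddEquiv.apply_symm_apply _ a)).trans
          (ha.trans (map_zero _).symm))
      · apply I.tensorHomEquivRes.injective
        refine (key _).trans ?_
        rw [AddEquiv.apply_symm_apply, hab]
        refine Eq.trans ?_ (map_add I.tensorHomEquivRes _ _).symm
        refine congrArg (fun t => _ + t) ?_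
        exact ((I.tensorHomEquivRes_comp _ _).trans
          (congrArg _ (AddEquiv.apply_symm_apply _ b))).symm
    · intro J _ g h hg e
      obtain ⟨a, ha⟩ := (comp ((zdual J).obj (Opposite.op F))).2 (tensorHomEquiv g)
        (I.tensorHomEquivRes h)
        ((tensorHomEquiv_comp _ _).symm.trans ((congrArg _ hg).trans (map_zero _)))
        ((key g).symm.trans ((congrArg _ e).trans (I.tensorHomEquivRes_comp _ _)))
      refine ⟨tensorHomEquiv.symm a, ?_⟩
      apply tensorHomEquiv.injective
      exact (tensorHomEquiv_comp _ _).trans ((congrArg _ (AddEquiv.apply_symm_apply _ a)).trans ha)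
  have hf : IsIso ((HomologicalComplex.homologyFunctor AddCommGrpCat.{u} (ComplexShape.down ℕ)
    (i + 1)).map f) := (quasiIsoAt_iff_isIso_homologyMap f (i + 1)).1 hq
  exact IsIso.comp_isIso' (P.isoLeftDerivedObj _ _).isIso_hom
    (IsIso.comp_isIso' hf (Q.isoLeftDerivedObj _ _).isIso_inv)

end CatIdeal

end TorComparison

/-! ### Restriction preserves limits and colimits; free covers and cofree hulls -/

section

variable {C D : Type u} [Category.{u} C] [Preadditive C] [Category.{u} D] [Preadditive D]

instance (J : Type u) [Category.{u} J] :
    PreservesLimitsOfShape J (AdditiveFunctor.forget C AddCommGrpCat.{u}) :=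
  inferInstanceAs (PreservesLimitsOfShape J (additiveFunctor C AddCommGrpCat.{u}).ι)

instance (J : Type u) [Category.{u} J] :
    PreservesColimitsOfShape J (AdditiveFunctor.forget C AddCommGrpCat.{u}) :=
  inferInstanceAs (PreservesColimitsOfShape J (additiveFunctor C AddCommGrpCat.{u}).ι)

variable (F : C ⥤ D) [F.Additive]

instance (J : Type u) [Category.{u} J] : PreservesLimitsOfShape J (res F) :=
  have : PreservesLimitsOfShape J (res F ⋙ AdditiveFunctor.forget C AddCommGrpCat.{u}) :=
    (inferInstance : PreservesLimitsOfShape J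
      (AdditiveFunctor.forget D AddCommGrpCat.{u} ⋙ (Functor.whiskeringLeft C D _).obj F))
  preservesLimitsOfShape_of_reflects_of_preserves _ (AdditiveFunctor.forget C AddCommGrpCat.{u})

instance (J : Type u) [Category.{u} J] : PreservesColimitsOfShape J (res F) :=
  have : PreservesColimitsOfShape J (res F ⋙ AdditiveFunctor.forget C AddCommGrpCat.{u}) :=
    (inferInstance : PreservesColimitsOfShape J
      (AdditiveFunctor.forget D AddCommGrpCat.{u} ⋙ (Functor.whiskeringLeft C D _).obj F))
  preservesColimitsOfShape_of_reflects_of_preserves _ (AdditiveFunctor.forget C AddCommGrpCat.{u})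

variable (M : CMod C)

/-- The canonical morphism from a coproduct of representable modules onto `M`. -/
def repCover : (∐ fun i : Σ X : C, M.obj.obj X => rep i.1) ⟶ M :=
  Sigma.desc fun i => repHom i.2

instance : Epi (repCover M) := by
  rw [epi_iff]
  intro X m
  refine ⟨(Sigma.ι (fun i : Σ X : C, M.obj.obj X => rep i.1) ⟨X, m⟩).hom.app X
    (𝟙 X : X ⟶ X), ?_⟩
  have h := Sigma.ι_desc (fun i : Σ X : C, M.obj.obj X => repHom i.2) ⟨X, m⟩
  refine (congrArg (fun φ => φ.hom.app X (𝟙 X : X ⟶ X)) h).trans ?_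
  change M.obj.map (𝟙 X) m = m
  rw [M.obj.map_id]; rfl

/-- The canonical morphism from `M` to a product of cofree modules. -/
def cofreeHull : M ⟶ ∏ᶜ fun X : C => cofree X (Injective.under (M.obj.obj X)) :=
  Pi.lift fun X => cofreeLift (Injective.ι (M.obj.obj X))

instance : Mono (cofreeHull M) := by
  rw [mono_iff]
  intro X m n h
  have e (a : M.obj.obj X) := congrArg (fun φ => φ.hom.app X a)
    (Pi.lift_π (fun X : C => cofreeLift (Injective.ι (M.obj.obj X))) X)
  have h2 := (e m).symm.trans ((congrArg ((Pi.π (fun X : C =>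
    cofree X (Injective.under (M.obj.obj X))) X).hom.app X) h).trans (e n))
  have h3 := congrArg (cofreeEval X _) h2
  change Injective.ι (M.obj.obj X) (M.obj.map (𝟙 X) m) =
    Injective.ι (M.obj.obj X) (M.obj.map (𝟙 X) n) at h3
  rw [M.obj.map_id] at h3
  exact (AddCommGrpCat.mono_iff_injective _).1 inferInstance h3

end

open CategoryTheory.Abelian

/-! ### Ext between finitely presented modules -/

section FinitelyPresented

variable {C : Type u} [Category.{u} C] [Preadditive C] [HasZeroObject C] [HasBinaryBiproducts C]
  [(isFP C).IsClosedUnderKernels]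

/-- The representable module as a finitely presented module. -/
abbrev repFP (X : C) : FPMod C := ⟨rep X, isFP_rep X⟩

instance (X : C) : Projective (repFP X) where
  factors {E N} k e he := by
    have : Epi e.hom := (inferInstance : Epi ((isFP C).ι.map e))
    exact ⟨ObjectProperty.homMk (Projective.factorThru k.hom e.hom),
      ObjectProperty.hom_ext _ (Projective.factorThru_comp k.hom e.hom)⟩

lemma exists_repFP_epi (M : FPMod C) : ∃ (X : C) (p : repFP X ⟶ M), Epi p := by
  obtain ⟨X₀, X₁, f, g, w, hex, hg⟩ := M.property
  exact ⟨X₁, ObjectProperty.homMk g, (isFP C).ι.epi_of_epi_map hg⟩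

/-- Finitely presented modules are covered by representables, which are projective in both mod(C)
and Mod(C), so the inclusion preserves Ext. -/
lemma subsingleton_ext_FPMod_iff (M N : FPMod C) (i : ℕ) :
    Subsingleton (Abelian.Ext.{u} M N i) ↔ Subsingleton (Abelian.Ext.{u} M.obj N.obj i) := by
  have h := mapExt_bijective_of_projective_cover (isFP C).ι N i (fun X => by
    obtain ⟨Y, p, hp⟩ := exists_repFP_epi X
    refine ⟨repFP Y, p, inferInstance, hp, fun i hi _ => ?_⟩
    obtain ⟨i, rfl⟩ := Nat.exists_eq_add_of_le' hi
    exact Ext.subsingleton_of_projective.{u} (rep Y) N.obj i) i le_rfl M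
  exact (Equiv.ofBijective _ h).subsingleton_congr

end FinitelyPresented

/-! ### Idempotence as vanishing of Ext on restricted representables -/

namespace CatIdeal

variable {C : Type u} [Category.{u} C] [Preadditive C] (I : CatIdeal C)

/-- Representables are projective over `C/I`, which forces the vanishing. Conversely, their
coproducts cover every module and `mapExt_bijective_of_projective_cover` applies. -/
lemma isKIdempotent_iff (k : ℕ) : I.IsKIdempotent k ↔
    ∀ (F : CMod I.Quot) (X : I.Quot) (i : ℕ), 1 ≤ i → i ≤ k →
      Subsingleton (Abelian.Ext.{u} (I.πStar.obj (rep X)) (I.πStar.obj F) i) := by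
  constructor
  · intro h F X i hi hik
    obtain ⟨i, rfl⟩ := Nat.exists_eq_add_of_le' hi
    have := Ext.subsingleton_of_projective.{u} (rep X) F i
    exact (h (i + 1) hik (rep X) F).surjective.subsingleton
  · intro h i hik F F'
    refine mapExt_bijective_of_projective_cover I.πStar F' k (fun M => ?_) i hik F
    refine ⟨_, repCover M, inferInstance, inferInstance, fun i hi hik => ?_⟩
    obtain ⟨i, rfl⟩ := Nat.exists_eq_add_of_le' hi
    have (j : Σ X : I.Quot, M.obj.obj X) := h F' j.1 (i + 1) hi hik
    -- `π_*` preserves coproducts, so the vanishing passes from representables to the free cover.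
    exact subsingleton_ext_of_isColimit_cofan _
      (isColimitCofanMkObjOfIsColimit I.πStar _ _ (coproductIsCoproduct _)) i

/-- Vanishing of `Ext^i(-, F ∘ π)` for all `F` may be tested on cofree modules. -/
lemma subsingleton_ext_πStar_of_cofree (k : ℕ) {X : I.Quot}
    (h : ∀ (Y : I.Quot) (A : AddCommGrpCat.{u}), Injective A → ∀ i : ℕ, 1 ≤ i → i ≤ k →
      Subsingleton (Abelian.Ext.{u} (I.πStar.obj (rep X)) (I.πStar.obj (cofree Y A)) i))
    (i : ℕ) (hi : 1 ≤ i) (hik : i ≤ k) (F : CMod I.Quot) :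
    Subsingleton (Abelian.Ext.{u} (I.πStar.obj (rep X)) (I.πStar.obj F) i) := by
  induction i using Nat.strong_induction_on generalizing F with
  | _ n ih =>
    let S : ShortComplex (CMod I.Quot) :=
      ShortComplex.mk (cofreeHull F) (cokernel.π _) (cokernel.condition _)
    have hS : S.ShortExact := { exact := ShortComplex.exact_cokernel _ }
    have hmid (i : ℕ) (hi : 1 ≤ i) (hik : i ≤ k) :
        Subsingleton (Abelian.Ext.{u} (I.πStar.obj (rep X)) (I.πStar.obj S.X₂) i) := by
      obtain ⟨i, rfl⟩ := Nat.exists_eq_add_of_le' hi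
      have (Y : I.Quot) := h Y (Injective.under (F.obj.obj Y)) inferInstance (i + 1) hi hik
      exact subsingleton_ext_of_isLimit_fan _
        (isLimitFanMkObjOfIsLimit I.πStar _ _ (productIsProduct _)) i
    -- The cokernel is handled in degrees below `n` by strong induction. In degree 0, a map into its
    -- restriction comes from `C/I` by fullness and lifts because `rep X` is projective.
    refine subsingleton_ext_of_shortExact (k := n) (hS.map_of_exact I.πStar) ?_
      (fun i hi hin => hmid i hi (hin.trans hik))
      (fun i hi hin => ih i (by lia) hi (by lia) S.X₃) n hi le_rfl
    intro f
    obtain ⟨g, rfl⟩ := I.πStar.map_surjective (X := rep X) (Y := S.X₃) f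
    have : Epi S.g := hS.epi_g
    exact ⟨I.πStar.map (Projective.factorThru g S.g),
      (I.πStar.map_comp _ _).symm.trans (congrArg _ (Projective.factorThru_comp g S.g))⟩

section

variable [HasZeroObject C] [HasBinaryBiproducts C] [(isFP I.Quot).IsClosedUnderKernels] {I}

/-- Vanishing of `Ext^i(-, F ∘ π)` for all `F` in `mod(C/I)` may be tested on injective objects
of `mod(C/I)`, provided that there are enough of them. -/
lemma subsingleton_ext_πStar_of_injective [EnoughInjectives (FPMod I.Quot)] (k : ℕ) {X : I.Quot}
    (h : ∀ J : FPMod I.Quot, Injective J → ∀ i : ℕ, 1 ≤ i → i ≤ k →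
      Subsingleton (Abelian.Ext.{u} (I.πStar.obj (rep X)) (I.πStar.obj J.obj) i))
    (i : ℕ) (hi : 1 ≤ i) (hik : i ≤ k) (F : FPMod I.Quot) :
    Subsingleton (Abelian.Ext.{u} (I.πStar.obj (rep X)) (I.πStar.obj F.obj) i) := by
  induction i using Nat.strong_induction_on generalizing F with
  | _ n ih =>
    -- The embedding is taken inside mod(C/I), so the cokernel stays finitely presented and the
    -- induction continues.
    let S : ShortComplex (FPMod I.Quot) :=
      ShortComplex.mk (Injective.ι F) (cokernel.π _) (cokernel.condition _)
    have hS : S.ShortExact := { exact := ShortComplex.exact_cokernel _ }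
    refine subsingleton_ext_of_shortExact (k := n)
      (hS.map_of_exact ((isFP I.Quot).ι ⋙ I.πStar)) ?_
      (fun i hi hin => h _ inferInstance i hi (hin.trans hik))
      (fun i hi hin => ih i (by lia) hi (by lia) S.X₃) n hi le_rfl
    intro f
    obtain ⟨g, rfl⟩ := I.πStar.map_surjective (X := rep X) (Y := S.X₃.obj) f
    have : Epi ((isFP I.Quot).ι.map S.g) := (hS.map_of_exact (isFP I.Quot).ι).epi_g
    exact ⟨I.πStar.map (Projective.factorThru g ((isFP I.Quot).ι.map S.g)),
      (I.πStar.map_comp _ _).symm.trans (congrArg _ (Projective.factorThru_comp g _))⟩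

variable [(isFP C).IsClosedUnderKernels]

instance (hI : I.PropertyA) : hI.πStarFP.Full where
  map_surjective {M N} φ := by
    obtain ⟨ψ, hψ⟩ := I.πStar.map_surjective (X := M.obj) (Y := N.obj) φ.hom
    exact ⟨ObjectProperty.homMk ψ, ObjectProperty.hom_ext _ hψ⟩

instance (hI : I.PropertyA) : hI.πStarFP.Faithful where
  map_injective h :=
    ObjectProperty.hom_ext _ (I.πStar.map_injective (congrArg (fun t => t.hom) h))

/-- The argument of `isKIdempotent_iff` without coproducts: a single representable covers each
finitely presented module. -/
lemma PropertyA.mapExt_πStarFP_bijective_iff (hI : I.PropertyA) (k : ℕ) :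
    (∀ i : ℕ, i ≤ k → ∀ F F' : FPMod I.Quot, Function.Bijective (hI.πStarFP.mapExtAddHom F F' i)) ↔
    ∀ (F : FPMod I.Quot) (X : I.Quot) (i : ℕ), 1 ≤ i → i ≤ k →
      Subsingleton (Abelian.Ext.{u} (I.πStar.obj (rep X)) (I.πStar.obj F.obj) i) := by
  constructor
  · intro h F X i hi hik
    obtain ⟨i, rfl⟩ := Nat.exists_eq_add_of_le' hi
    have := Ext.subsingleton_of_projective.{u} (repFP X) F i
    exact (subsingleton_ext_FPMod_iff (hI.πStarFP.obj (repFP X)) (hI.πStarFP.obj F) (i + 1)).1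
      (h (i + 1) hik (repFP X) F).surjective.subsingleton
  · intro h i hik F F'
    refine mapExt_bijective_of_projective_cover hI.πStarFP F' k (fun M => ?_) i hik F
    obtain ⟨X, p, hp⟩ := exists_repFP_epi M
    exact ⟨repFP X, p, inferInstance, hp, fun i hi hik =>
      (subsingleton_ext_FPMod_iff (hI.πStarFP.obj (repFP X)) (hI.πStarFP.obj F') i).2
        (h F' X i hi hik)⟩

end

end CatIdeal

open CategoryTheory.Abelian

/-! ### Dimension shifting in the first variable -/

section

variable {A : Type*} [Category* A] [Abelian A] [HasExt.{u} A] {S : ShortComplex A}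

/-- Dimension shifting in the first variable. -/
lemma subsingleton_ext_succ_iff (hS : S.ShortExact) [Projective S.X₂] (N : A) (n : ℕ) :
    Subsingleton (Abelian.Ext.{u} S.X₃ N (n + 2)) ↔
      Subsingleton (Abelian.Ext.{u} S.X₁ N (n + 1)) := by
  have (i : ℕ) : Subsingleton (Abelian.Ext.{u} S.X₂ N (i + 1)) :=
    Ext.subsingleton_of_projective.{u} S.X₂ N i
  constructor
  · intro h
    refine subsingleton_of_forall_eq 0 fun x => ?_
    obtain ⟨y, rfl⟩ := Ext.contravariant_sequence_exact₁ hS N x (n₁ := n + 2) (by lia)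
      (Subsingleton.elim _ _)
    rw [Subsingleton.elim y 0, Ext.comp_zero]
  · intro h
    refine subsingleton_of_forall_eq 0 fun x => ?_
    obtain ⟨y, rfl⟩ := Ext.contravariant_sequence_exact₃ hS N x ((this (n + 1)).elim _ _)
      (n₀ := n + 1) (by lia)
    rw [Subsingleton.elim y 0, Ext.comp_zero]

lemma subsingleton_ext_one_iff (hS : S.ShortExact) [Projective S.X₂] (N : A) :
    Subsingleton (Abelian.Ext.{u} S.X₃ N 1) ↔ ∀ f : S.X₁ ⟶ N, ∃ g, S.f ≫ g = f := by
  have : Subsingleton (Abelian.Ext.{u} S.X₂ N 1) := Ext.subsingleton_of_projective.{u} S.X₂ N 0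
  constructor
  · intro h f
    obtain ⟨y, hy⟩ := Ext.contravariant_sequence_exact₁ hS N (Ext.mk₀ f) (n₁ := 1) (by lia)
      (Subsingleton.elim _ _)
    obtain ⟨g, rfl⟩ := (Ext.mk₀_bijective _ _).2 y
    exact ⟨g, (Ext.mk₀_bijective _ _).1 (by simpa using hy)⟩
  · intro h
    refine subsingleton_of_forall_eq 0 fun x => ?_
    obtain ⟨y, rfl⟩ := Ext.contravariant_sequence_exact₃ hS N x (Subsingleton.elim _ _)
      (n₀ := 0) (by lia)
    obtain ⟨f, rfl⟩ := (Ext.mk₀_bijective _ _).2 y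
    obtain ⟨g, rfl⟩ := h f
    rw [← Ext.mk₀_comp_mk₀, ← Ext.comp_assoc (a₁₂ := 1) _ _ _ (by lia) (by lia) (by lia),
      ShortComplex.ShortExact.extClass_comp, Ext.zero_comp]

end

/-! ### Ext out of finitely presented modules and double duals -/

section

variable {C : Type u} [Category.{u} C] [Preadditive C] [HasZeroObject C] [HasBinaryBiproducts C]
  [(isFP C).IsClosedUnderKernels]

/-- Dimension shifting reduces to degree 1. There the kernel `K` of a cover `rep X ⟶ G` has a
generator in `K(Y)` subject to a relation `g`. Maps `K ⟶ N` are the elements of `N(Y)` killed by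
`g`, and those extending to `rep X` form the image of `N(f)`. -/
lemma exists_ext_iff_exact (n : ℕ) (G : FPMod C) : ∃ (X Y Z : C) (f : X ⟶ Y) (g : Y ⟶ Z),
    f ≫ g = 0 ∧ ∀ N : CMod C, Subsingleton (Abelian.Ext.{u} G.obj N (n + 1)) ↔
      Function.Exact (N.obj.map f) (N.obj.map g) := by
  induction n generalizing G with
  | zero =>
    obtain ⟨X, p, hp⟩ := exists_repFP_epi G
    let S := ShortComplex.mk _ _ (kernel.condition p)
    have hS : S.ShortExact := { exact := ShortComplex.exact_kernel p }
    have hS' := hS.map_of_exact (isFP C).ι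
    have : Projective (S.map (isFP C).ι).X₂ := projective_rep X
    obtain ⟨Z, Y, a, e, w, hex, he⟩ := S.X₁.property
    let ι : S.X₁.obj ⟶ rep X := S.f.hom
    let y : S.X₁.obj.obj.obj Y := e.hom.app Y (𝟙 Y : Y ⟶ Y)
    let g : Y ⟶ Z := a.hom.app Z (𝟙 Z : Z ⟶ Z)
    let f : X ⟶ Y := ι.hom.app Y y
    have hgy : S.X₁.obj.obj.map g y = 0 :=
      (rep_hom_app e g).symm.trans (congrArg (fun t => t.hom.app Z (𝟙 Z : Z ⟶ Z)) w)
    have hfg : f ≫ g = 0 :=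
      (hom_app_map ι g y).symm.trans ((congrArg (ι.hom.app Z) hgy).trans (map_zero _))
    refine ⟨X, Y, Z, f, g, hfg, fun N => (subsingleton_ext_one_iff hS' N).trans ⟨?_, ?_⟩⟩
    · refine fun H x => ⟨fun hx => ?_, ?_⟩
      · have hx' : a ≫ repHom x = 0 := rep_hom_ext hx
        let φ : S.X₁.obj ⟶ N := hex.desc (repHom x) hx'
        have hφ : e ≫ φ = repHom x := hex.g_desc (repHom x) hx'
        obtain ⟨ψ, hψ⟩ := H φ
        refine ⟨ψ.hom.app X (𝟙 X : X ⟶ X), ?_⟩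
        refine (rep_hom_app ψ f).symm.trans ?_
        refine (congrArg (fun t => t.hom.app Y y) hψ).trans ?_
        refine (congrArg (fun t => t.hom.app Y (𝟙 Y : Y ⟶ Y)) hφ).trans ?_
        change N.obj.map (𝟙 Y) x = x
        rw [N.obj.map_id]
        rfl
      · rintro ⟨z, rfl⟩
        rw [← AddCommGrpCat.comp_apply, ← Functor.map_comp, hfg, Functor.map_zero]
        rfl
    · intro H φ
      obtain ⟨z, hz⟩ := (H (φ.hom.app Y y)).1 ((hom_app_map φ g y).symm.trans
        ((congrArg (φ.hom.app Z) hgy).trans (map_zero _)))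
      refine ⟨repHom z, ?_⟩
      exact (cancel_epi e).1 (rep_hom_ext hz)
  | succ n ih =>
    obtain ⟨X, p, hp⟩ := exists_repFP_epi G
    let S := ShortComplex.mk _ _ (kernel.condition p)
    have hS : S.ShortExact := { exact := ShortComplex.exact_kernel p }
    have : Projective (S.map (isFP C).ι).X₂ := projective_rep X
    obtain ⟨X, Y, Z, f, g, w, h⟩ := ih S.X₁
    exact ⟨X, Y, Z, f, g, w, fun N =>
      (subsingleton_ext_succ_iff (hS.map_of_exact (isFP C).ι) N n).trans (h N)⟩

/-- `Hom_R(-, E)` and `Hom_ℤ(-, A)` are exact; the first reverses the arrows and the second restores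
them. -/
lemma exact_map_zdual_dualFunctor {R : Type u} [CommRing R] {C : Type u} [Category.{u} C]
    [Preadditive C] [Linear R C] (E : ModuleCat.{u} R) [Injective E] (A : AddCommGrpCat.{u})
    [Injective A] (M : CMod C) {X Y Z : C} {f : X ⟶ Y} {g : Y ⟶ Z} (w : f ≫ g = 0)
    (h : Function.Exact (M.obj.map f) (M.obj.map g)) :
    Function.Exact (((zdual A).obj (op ((dualFunctor R E).obj (op M)))).obj.map f)
      (((zdual A).obj (op ((dualFunctor R E).obj (op M)))).obj.map g) := by
  let S : ShortComplex (ModuleCat.{u} R) :=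
    ShortComplex.mk (((toModuleCat R).obj M).map f) (((toModuleCat R).obj M).map g)
      (by rw [← Functor.map_comp, w, Functor.map_zero])
  have hS : S.Exact := (ShortComplex.ShortExact.moduleCat_exact_iff_function_exact S).2 h
  let N := (dualFunctor R E).obj (op M)
  let T : ShortComplex AddCommGrpCat.{u} :=
    ShortComplex.mk (N.obj.map g.op) (N.obj.map f.op)
      (by rw [← Functor.map_comp, ← op_comp, w, op_zero, Functor.map_zero])
  have hT : T.Exact := by
    rw [ShortComplex.ab_exact_iff]
    intro φ hφ
    exact ⟨hS.descToInjective φ hφ, hS.comp_descToInjective φ hφ⟩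
  intro φ
  constructor
  · intro hφ
    exact ⟨hT.descToInjective φ hφ, hT.comp_descToInjective φ hφ⟩
  · rintro ⟨ψ, rfl⟩
    rw [← AddCommGrpCat.comp_apply, ← Functor.map_comp, w, Functor.map_zero]
    rfl

/-- If `Ext^i(G, M) = 0` for a finitely presented module `G`, then
`Ext^i(G, Hom_ℤ(Hom_R(M, E), A)) = 0` for injective `E` and `A`. -/
lemma subsingleton_ext_zdual_dualFunctor {R : Type u} [CommRing R] {C : Type u} [Category.{u} C]
    [Preadditive C] [Linear R C] [HasZeroObject C] [HasBinaryBiproducts C]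
    [(isFP C).IsClosedUnderKernels] (E : ModuleCat.{u} R) [Injective E] (A : AddCommGrpCat.{u})
    [Injective A] (G : FPMod C) (M : CMod C) (n : ℕ)
    (h : Subsingleton (Abelian.Ext.{u} G.obj M (n + 1))) :
    Subsingleton (Abelian.Ext.{u} G.obj
      ((zdual A).obj (op ((dualFunctor R E).obj (op M)))) (n + 1)) := by
  obtain ⟨X, Y, Z, f, g, w, hG⟩ := exists_ext_iff_exact n G
  exact (hG _).2 (exact_map_zdual_dualFunctor E A M w ((hG M).1 h))

end

/-! ### The injective envelope of `R/rad(R)` as a cogenerator -/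

section InjectiveEnvelope

variable {R : Type u} [CommRing R] [IsArtinianRing R]

/-- Over a commutative artinian ring, the annihilator of some nonzero element of `R/rad(R)`
contains a given maximal ideal. -/
lemma exists_ne_zero_smul_eq_zero (m : Ideal R) [hm : m.IsMaximal] :
    ∃ s : R ⧸ Ring.jacobson R, s ≠ 0 ∧ ∀ a ∈ m, a • s = 0 := by
  have hJ : Ring.jacobson R ≤ m := Ring.jacobson_le_of_isMaximal m
  let m' := m.map (Ideal.Quotient.mk (Ring.jacobson R))
  -- `R/rad(R)` is semisimple, so `m'` has a complement `N`. It is nonzero because `m'` is proper,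
  -- and `m'` kills it because `m' * N ⊆ m' ⊓ N`.
  obtain ⟨N, hN⟩ := exists_isCompl (m' : Submodule (R ⧸ Ring.jacobson R) (R ⧸ Ring.jacobson R))
  have hN0 : N ≠ ⊥ := by
    rintro rfl
    have h1 : m' = ⊤ := by simpa using hN.sup_eq_top
    have h2 : (1 : R ⧸ Ring.jacobson R) ∈ m' := by rw [h1]; trivial
    rw [Ideal.mem_map_iff_of_surjective _ Ideal.Quotient.mk_surjective] at h2
    obtain ⟨x, hx, h⟩ := h2
    refine hm.ne_top ((Ideal.eq_top_iff_one m).2 ?_)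
    have : x - 1 ∈ Ring.jacobson R := by
      rw [← Ideal.Quotient.eq_zero_iff_mem, map_sub, h, map_one, sub_self]
    simpa using sub_mem hx (hJ this)
  obtain ⟨s, hs, hs0⟩ := Submodule.exists_mem_ne_zero_of_ne_bot hN0
  refine ⟨s, hs0, fun a ha => ?_⟩
  have h1 : Ideal.Quotient.mk _ a * s ∈ m' := Ideal.mul_mem_right _ _ (Ideal.mem_map_of_mem _ ha)
  have h2 : Ideal.Quotient.mk _ a * s ∈ N := Submodule.smul_mem N _ hs
  have h3 := (Submodule.disjoint_def.1 hN.disjoint) _ h1 h2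
  rw [Algebra.smul_def]
  exact h3

/-- The injective envelope of `R/rad(R)` is a cogenerator. -/
lemma exists_linearMap_apply_ne_zero {E : Type u} [AddCommGroup E] [Module R E]
    (hE : IsInjectiveEnvelope R (R ⧸ Ring.jacobson R) E) {V : Type u} [AddCommGroup V] [Module R V]
    {v : V} (hv : v ≠ 0) : ∃ φ : V →ₗ[R] E, φ v ≠ 0 := by
  obtain ⟨hinj, ι, hι, -⟩ := hE
  let t := LinearMap.toSpanSingleton R V v
  -- `ker t` is the annihilator of `v`. For `s` killed by a maximal ideal containing it, `v ↦ ι s`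
  -- is well defined on the submodule generated by `v`, and injectivity of `E` extends it to `V`.
  obtain ⟨m, hm, htm⟩ := Ideal.exists_le_maximal (LinearMap.ker t) (by
    rw [Ideal.ne_top_iff_one]
    simpa [t] using hv)
  obtain ⟨s, hs0, hs⟩ := exists_ne_zero_smul_eq_zero m
  let f := LinearMap.toSpanSingleton R E (ι s)
  have hf : LinearMap.ker t ≤ LinearMap.ker f := fun a ha => by
    simp only [f, LinearMap.mem_ker, LinearMap.toSpanSingleton_apply]
    rw [← map_smul, hs a (htm ha), map_zero]
  obtain ⟨φ, hφ⟩ := hinj.out ((LinearMap.ker t).liftQ t le_rfl)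
    (LinearMap.ker_eq_bot.1 (Submodule.ker_liftQ_eq_bot _ _ _ le_rfl))
    ((LinearMap.ker t).liftQ f hf)
  refine ⟨φ, ?_⟩
  have := hφ (Submodule.Quotient.mk 1)
  simp only [Submodule.liftQ_apply, t, f, LinearMap.toSpanSingleton_apply, one_smul] at this
  rw [this]
  exact fun h => hs0 (hι (h.trans (map_zero ι).symm))

end InjectiveEnvelope

/-! ### Modules annihilated by the ideal -/

namespace CatIdeal

variable {C : Type u} [Category.{u} C] [Preadditive C] {I : CatIdeal C}

/-- Modules annihilated by `I` are modules over `C/I`. -/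
lemma exists_πStar_iso (M : CMod C)
    (hM : ∀ ⦃X Y : C⦄ (f : X ⟶ Y), f ∈ I.hom X Y → M.obj.map f = 0) :
    ∃ M' : CMod I.Quot, Nonempty (I.πStar.obj M' ≅ M) := by
  have hM' (X Y : C) (f g : X ⟶ Y) (h : I.rel f g) : M.obj.map f = M.obj.map g := by
    rw [← sub_eq_zero, ← Functor.map_sub]
    exact hM _ h
  let N := CategoryTheory.Quotient.lift I.rel M.obj hM'
  have hN : N.Additive := ⟨fun {X Y f g} => by
    obtain ⟨X⟩ := X
    obtain ⟨Y⟩ := Y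
    obtain ⟨f, rfl⟩ := I.π.map_surjective (X := X) (Y := Y) f
    obtain ⟨g, rfl⟩ := I.π.map_surjective (X := X) (Y := Y) g
    rw [← Functor.map_add]
    exact M.obj.map_add⟩
  exact ⟨⟨N, hN⟩, ⟨(ObjectProperty.fullyFaithfulι _).preimageIso
    (NatIso.ofComponents (fun X => Iso.refl _) fun f =>
      (Category.comp_id _).trans (Category.id_comp _).symm)⟩⟩

lemma πStar_map_eq_zero (M : CMod I.Quot) {X Y : C} {f : X ⟶ Y} (hf : f ∈ I.hom X Y) :
    (I.πStar.obj M).obj.map f = 0 := by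
  have : I.π.map f = 0 := by
    rw [← I.π.map_zero, π_map_eq_iff, sub_zero]
    exact hf
  change M.obj.map (I.π.map f) = 0
  rw [this, Functor.map_zero]

lemma πStarOp_map_eq_zero (M : CMod I.Quotᵒᵖ) {X Y : C} {f : X ⟶ Y} (hf : f ∈ I.hom X Y) :
    (I.πStarOp.obj M).obj.map f.op = 0 := by
  have : I.π.map f = 0 := by
    rw [← I.π.map_zero, π_map_eq_iff, sub_zero]
    exact hf
  change M.obj.map (I.π.map f).op = 0
  rw [this, op_zero, Functor.map_zero]

/-- The identity as an element of `C(-, Y)/I(-, Y)`. -/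
def quotRightId (Y : C) : (I.quotRight.obj (I.π.obj Y)).obj.obj (Opposite.op Y) :=
  (𝟙 (I.π.obj Y) : I.π.obj Y ⟶ I.π.obj Y)

lemma quotRight_map_id {X Y : C} (f : X ⟶ Y) :
    (I.quotRight.obj (I.π.obj Y)).obj.map f.op (quotRightId Y) = (I.π.map f : I.π.obj X ⟶ I.π.obj Y) :=
  Category.comp_id (I.π.map f)

lemma exists_quotRight_map_eq {X Y : C}
    (q : (I.quotRight.obj (I.π.obj Y)).obj.obj (Opposite.op X)) :
    ∃ f : X ⟶ Y, (I.quotRight.obj (I.π.obj Y)).obj.map f.op (quotRightId Y) = q := by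
  obtain ⟨f, hf⟩ := I.π.map_surjective (X := X) (Y := Y) q
  exact ⟨f, (quotRight_map_id f).trans hf⟩

/-- The morphism from `C(-, Y)/I(-, Y)` to a module annihilated by `I` given by an element. -/
lemma exists_quotRight_hom {Y : C} (N : CMod Cᵒᵖ)
    (hN : ∀ ⦃X Y : C⦄ (f : X ⟶ Y), f ∈ I.hom X Y → N.obj.map f.op = 0)
    (n : N.obj.obj (Opposite.op Y)) :
    ∃ φ : I.quotRight.obj (I.π.obj Y) ⟶ N, φ.hom.app _ (quotRightId Y) = n := by
  have hN' {X : C} {f g : X ⟶ Y} (h : I.π.map f = I.π.map g) :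
      N.obj.map f.op n = N.obj.map g.op n := by
    rw [← sub_eq_zero]
    have e : N.obj.map (f - g).op = 0 := hN _ ((π_map_eq_iff I f g).1 h)
    rw [op_sub, Functor.map_sub] at e
    exact ConcreteCategory.congr_hom e n
  -- A preimage under `π` is chosen; by `hN'` the value does not depend on the choice.
  let a (X : Cᵒᵖ) : (I.quotRight.obj (I.π.obj Y)).obj.obj X → N.obj.obj X := fun q =>
    N.obj.map (I.π.preimage (X := X.unop) (Y := Y) q).op n
  have ha (X : C) (f : X ⟶ Y) : a (Opposite.op X) (I.π.map f) = N.obj.map f.op n :=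
    hN' (I.π.map_preimage _)
  refine ⟨ObjectProperty.homMk
    { app := fun X => AddCommGrpCat.ofHom (AddMonoidHom.mk' (a X) fun q q' => ?_)
      naturality := fun X X' g => ?_ }, ?_⟩
  · obtain ⟨X⟩ := X
    obtain ⟨f, rfl⟩ := I.π.map_surjective (X := X) (Y := Y) q
    obtain ⟨f', rfl⟩ := I.π.map_surjective (X := X) (Y := Y) q'
    refine (congrArg (a _) (I.π.map_add (f := f) (g := f')).symm).trans ?_
    refine (ha X _).trans ?_
    rw [ha, ha, op_add, Functor.map_add]
    rfl
  · ext q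
    obtain ⟨X⟩ := X
    obtain ⟨X'⟩ := X'
    obtain ⟨f, rfl⟩ := I.π.map_surjective (X := X) (Y := Y) q
    have e1 := congrArg (a (Opposite.op X')) (I.π.map_comp g.unop f).symm
    refine e1.trans ((ha X' _).trans ?_)
    refine Eq.trans ?_ (congrArg (N.obj.map g) (ha X f)).symm
    exact ConcreteCategory.congr_hom (N.obj.map_comp f.op g) n
  · refine (congrArg (a _) (I.π.map_id Y).symm).trans ((ha Y _).trans ?_)
    exact ConcreteCategory.congr_hom (N.obj.map_id _) n

lemma quotRight_hom_ext {Y : C} {N : CMod Cᵒᵖ} {φ ψ : I.quotRight.obj (I.π.obj Y) ⟶ N}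
    (h : φ.hom.app _ (quotRightId Y) = ψ.hom.app _ (quotRightId Y)) : φ = ψ := by
  ext ⟨X⟩ q
  obtain ⟨f, rfl⟩ := exists_quotRight_map_eq q
  exact (hom_app_map φ f.op _).trans ((congrArg _ h).trans (hom_app_map ψ f.op _).symm)

lemma PropertyA.exists_cogenerator (hI : I.PropertyA) (X : C) :
    ∃ (Y : C) (i : Y ⟶ X), i ∈ I.hom Y X ∧
      ∀ (Z : C) (f : Z ⟶ X), f ∈ I.hom Z X → ∃ g : Z ⟶ Y, g ≫ i = f := by
  obtain ⟨Y, p, hp⟩ := hI.right X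
  rw [epi_iff] at hp
  let i : I.op.hom (Opposite.op X) (Opposite.op Y) := p.hom.app (Opposite.op Y)
    (𝟙 (Opposite.op Y) : Opposite.op Y ⟶ Opposite.op Y)
  refine ⟨Y, i.1.unop, i.2, fun Z f hf => ?_⟩
  obtain ⟨g, hg⟩ := hp (Opposite.op Z) (show (I.op.left (Opposite.op X)).obj.obj (Opposite.op Z)
    from (⟨f.op, hf⟩ : I.op.hom (Opposite.op X) (Opposite.op Z)))
  refine ⟨(show Opposite.op Y ⟶ Opposite.op Z from g).unop, congrArg Quiver.Hom.unop ?_⟩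
  exact congrArg Subtype.val (show (show I.op.hom (Opposite.op X) (Opposite.op Z) from
    (I.op.left (Opposite.op X)).obj.map (show Opposite.op Y ⟶ Opposite.op Z from g) i) =
    ⟨f.op, hf⟩ from (rep_hom_app p g).symm.trans hg)

/-- The class of the identity generates, and by the second half of property A a single morphism `Z ⟶
Y` generates the relations `I(-, Y)`. -/
lemma PropertyA.isFP_quotRight (hI : I.PropertyA) (Y : C) :
    isFP Cᵒᵖ (I.quotRight.obj (I.π.obj Y)) := by
  rw [isFP_iff]
  obtain ⟨Z, i, hi, hZ⟩ := hI.exists_cogenerator Y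
  refine ⟨Opposite.op Y, quotRightId Y, Opposite.op Z, i.op, fun X m => ?_, ?_, fun X f hf => ?_⟩
  · obtain ⟨f, hf⟩ := exists_quotRight_map_eq (X := X.unop) m
    exact ⟨f.op, hf⟩
  · exact ConcreteCategory.congr_hom (πStarOp_map_eq_zero (corepFunctor.obj (I.π.obj Y)) hi) _
  · have h1 : I.π.map f.unop = I.π.map 0 :=
      (quotRight_map_id f.unop).symm.trans (hf.trans (I.π.map_zero _ _).symm)
    rw [π_map_eq_iff, sub_zero] at h1
    obtain ⟨g, hg⟩ := hZ _ _ h1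
    exact ⟨g.op, congrArg Quiver.Hom.op hg⟩

end CatIdeal

/-! ### Duality and injective objects of mod(C/I) -/

section Dual

variable {R : Type u} [CommRing R] {C : Type u} [Category.{u} C] [Preadditive C] [Linear R C]
  {E : ModuleCat.{u} R}

/-- Evaluation of an element of the dual module. -/
def dualEval {M : CMod C} {X : C} (ξ : ((dualFunctor R E).obj (op M)).obj.obj (op X)) :
    ((toModuleCat R).obj M).obj X ⟶ E := ξ

lemma dualEval_map {M : CMod C} {X Y : C} (f : X ⟶ Y)
    (ξ : ((dualFunctor R E).obj (op M)).obj.obj (op Y)) (m : M.obj.obj X) :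
    dualEval (((dualFunctor R E).obj (op M)).obj.map f.op ξ) m = dualEval ξ (M.obj.map f m) := rfl

lemma exists_hom_apply_ne_zero [IsArtinianRing R] {V : ModuleCat.{u} R}
    (hE : IsInjectiveEnvelope R (R ⧸ Ring.jacobson R) E) {v : V} (hv : v ≠ 0) :
    ∃ φ : V ⟶ E, φ v ≠ 0 := by
  obtain ⟨φ, hφ⟩ := exists_linearMap_apply_ne_zero hE hv
  exact ⟨ModuleCat.ofHom φ, hφ⟩

lemma exists_dualEval_ne_zero (hE : IsInjectiveEnvelope R (R ⧸ Ring.jacobson R) E)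
    [IsArtinianRing R] {M : CMod C} {X : C} {m : M.obj.obj X} (hm : m ≠ 0) :
    ∃ ξ : ((dualFunctor R E).obj (op M)).obj.obj (op X), dualEval ξ m ≠ 0 := by
  exact exists_hom_apply_ne_zero (V := ((toModuleCat R).obj M).obj X) hE hm

lemma dualFunctor_map_surjective [Injective E] {M N : CMod C} (φ : M ⟶ N) [Mono φ] (X : C) :
    Function.Surjective (((dualFunctor R E).map φ.op).hom.app (op X)) := by
  intro ξ
  have : Mono (((toModuleCat R).map φ).app X) :=
    (ModuleCat.mono_iff_injective _).2 ((mono_iff φ).1 inferInstance X)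
  let ξ' : ((toModuleCat R).obj M).obj X ⟶ E := ξ
  exact ⟨Injective.factorThru ξ' (((toModuleCat R).map φ).app X),
    Injective.comp_factorThru ξ' (((toModuleCat R).map φ).app X)⟩


/-- The duality from `mod(C)` to `mod(Cᵒᵖ)` induced by `dualFunctor`. -/
abbrev dualFP (h : ∀ M : CMod C, isFP C M → isFP Cᵒᵖ ((dualFunctor R E).obj (op M))) :
    (FPMod C)ᵒᵖ ⥤ FPMod Cᵒᵖ :=
  (isFP Cᵒᵖ).lift ((isFP C).ι.op ⋙ dualFunctor R E) fun M => h _ M.unop.property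

variable {h : ∀ M : CMod C, isFP C M → isFP Cᵒᵖ ((dualFunctor R E).obj (Opposite.op M))}

lemma exists_dualFunctor_map_eq [(dualFP h).Full] {M N : CMod C} (hM : isFP C M) (hN : isFP C N)
    (φ : (dualFunctor R E).obj (op N) ⟶ (dualFunctor R E).obj (op M)) :
    ∃ ψ : M ⟶ N, (dualFunctor R E).map ψ.op = φ := by
  let M' : FPMod C := ⟨M, hM⟩
  let N' : FPMod C := ⟨N, hN⟩
  obtain ⟨ψ, hψ⟩ := (dualFP h).map_surjective (X := op N') (Y := op M') (ObjectProperty.homMk φ)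
  exact ⟨ψ.unop.hom, congrArg (fun t => t.hom) hψ⟩

lemma eq_of_dualFunctor_map_eq [(dualFP h).Faithful] {M N : CMod C} (hM : isFP C M)
    (hN : isFP C N) {φ ψ : M ⟶ N}
    (e : (dualFunctor R E).map φ.op = (dualFunctor R E).map ψ.op) : φ = ψ := by
  let M' : FPMod C := ⟨M, hM⟩
  let N' : FPMod C := ⟨N, hN⟩
  let φ' : M' ⟶ N' := ObjectProperty.homMk φ
  let ψ' : M' ⟶ N' := ObjectProperty.homMk ψ
  have := (dualFP h).map_injective (a₁ := φ'.op) (a₂ := ψ'.op) (ObjectProperty.hom_ext _ e)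
  exact congrArg (fun t => t.unop.hom) this

namespace CatIdeal

variable {I : CatIdeal C}

lemma dualFunctor_map_eq_zero (M : CMod I.Quot) {X Y : C} {f : X ⟶ Y} (hf : f ∈ I.hom X Y) :
    ((dualFunctor R E).obj (Opposite.op (I.πStar.obj M))).obj.map f.op = 0 := by
  ext ξ
  refine ModuleCat.hom_ext (LinearMap.ext fun m => ?_)
  refine (dualEval_map f ξ m).trans ?_
  rw [πStar_map_eq_zero M hf]
  exact map_zero (dualEval ξ).hom

variable [HasBinaryBiproducts C]

/-- The module `C(-, Y)/I(-, Y)` is the dual of a finitely presented `C/I`-module. -/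
lemma PropertyA.exists_dual_iso_quotRight [IsArtinianRing R]
    (hE : IsInjectiveEnvelope R (R ⧸ Ring.jacobson R) E)
    [(dualFP h).EssSurj] (hI : I.PropertyA) (Y : C) :
    ∃ M : FPMod I.Quot, Nonempty ((dualFunctor R E).obj (Opposite.op (I.πStar.obj M.obj)) ≅
      I.quotRight.obj (I.π.obj Y)) := by
  let e := (dualFP h).objObjPreimageIso ⟨_, hI.isFP_quotRight Y⟩
  let N := ((dualFP h).objPreimage ⟨_, hI.isFP_quotRight Y⟩).unop
  let e' : (dualFunctor R E).obj (Opposite.op N.obj) ≅ I.quotRight.obj (I.π.obj Y) :=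
    (isFP Cᵒᵖ).ι.mapIso e
  -- `I` annihilates the dual of `N`; since maps to `E` separate elements, it annihilates `N`.
  obtain ⟨M, ⟨i⟩⟩ := I.exists_πStar_iso N.obj (fun X X' f hf => by
    ext m
    by_contra hm
    obtain ⟨ξ, hξ⟩ := exists_dualEval_ne_zero hE hm
    apply hξ
    rw [← dualEval_map]
    have h1 : ((dualFunctor R E).obj (Opposite.op N.obj)).obj.map f.op ξ = 0 := by
      apply (mono_iff e'.hom).1 inferInstance
      rw [hom_app_map, map_zero]
      exact ConcreteCategory.congr_hom
        (πStarOp_map_eq_zero (corepFunctor.obj (I.π.obj Y)) hf) _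
    exact congrArg (fun t => dualEval t m) h1)
  have hM : isFP I.Quot M := isFP_of_isFP_πStar M ((isFP C).prop_of_iso i.symm N.property)
  exact ⟨⟨M, hM⟩, ⟨(dualFunctor R E).mapIso i.op.symm ≪≫ e'⟩⟩

variable [HasZeroObject C]

section Universal

variable (hI : I.PropertyA) {M : FPMod I.Quot} {Y : C}
  (e : (dualFunctor R E).obj (Opposite.op (I.πStar.obj M.obj)) ≅ I.quotRight.obj (I.π.obj Y))

include hI e

/-- With `hom_ext_of_dual_iso_quotRight`, this says that `M` represents `F ↦ Hom_R(F(Y), E)` on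
mod(C/I). By duality, maps `F ⟶ M` are maps from `C(-, Y)/I(-, Y)` to the dual of `π_* F`; as `I`
annihilates that dual, such maps are its elements over `Y`. -/
lemma exists_hom_of_dual_iso_quotRight [(dualFP h).Full] (F : FPMod I.Quot)
    (ξ : ((dualFunctor R E).obj (Opposite.op (I.πStar.obj F.obj))).obj.obj (Opposite.op Y)) :
    ∃ g : F ⟶ M, ((dualFunctor R E).map (I.πStar.map g.hom).op).hom.app _
      (e.inv.hom.app _ (quotRightId Y)) = ξ := by
  obtain ⟨φ, hφ⟩ := exists_quotRight_hom _ (fun _ _ _ => dualFunctor_map_eq_zero F.obj) ξ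
  obtain ⟨ψ, hψ⟩ := exists_dualFunctor_map_eq (h := h) (hI.isFP_πStar _ F.property)
    (hI.isFP_πStar _ M.property) (e.hom ≫ φ)
  obtain ⟨g, rfl⟩ := I.πStar.map_surjective (X := F.obj) (Y := M.obj) ψ
  refine ⟨ObjectProperty.homMk g, ?_⟩
  refine (congrArg (fun t => t.hom.app _ (e.inv.hom.app _ (quotRightId Y))) hψ).trans ?_
  refine Eq.trans (congrArg (φ.hom.app _) ?_) hφ
  exact congrArg (fun t => t.hom.app _ (quotRightId Y)) e.inv_hom_id

lemma hom_ext_of_dual_iso_quotRight [(dualFP h).Faithful] {F : FPMod I.Quot} {g g' : F ⟶ M}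
    (w : ((dualFunctor R E).map (I.πStar.map g.hom).op).hom.app _
        (e.inv.hom.app _ (quotRightId Y)) =
      ((dualFunctor R E).map (I.πStar.map g'.hom).op).hom.app _
        (e.inv.hom.app _ (quotRightId Y))) : g = g' := by
  apply ObjectProperty.hom_ext
  apply I.πStar.map_injective
  refine eq_of_dualFunctor_map_eq (h := h) (hI.isFP_πStar _ F.property)
    (hI.isFP_πStar _ M.property) ?_
  rw [← cancel_epi e.inv]
  exact quotRight_hom_ext w

/-- The functor represented by `M` sends monomorphisms to surjections because `E` is injective. -/
lemma injective_of_dual_iso_quotRight [Injective E] [(dualFP h).Full] [(dualFP h).Faithful]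
    [(isFP C).IsClosedUnderKernels] [(isFP I.Quot).IsClosedUnderKernels] : Injective M where
  factors {K K'} g f _ := by
    have : Mono ((isFP I.Quot).ι.map f) := inferInstance
    have : Mono (I.πStar.map ((isFP I.Quot).ι.map f)) := inferInstance
    obtain ⟨ξ, hξ⟩ := dualFunctor_map_surjective (E := E) (I.πStar.map ((isFP I.Quot).ι.map f)) Y
      (((dualFunctor R E).map (I.πStar.map g.hom).op).hom.app _
        (e.inv.hom.app _ (quotRightId Y)))
    obtain ⟨g', rfl⟩ := exists_hom_of_dual_iso_quotRight (h := h) hI e K' ξ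
    exact ⟨g', hom_ext_of_dual_iso_quotRight (h := h) hI e hξ⟩

end Universal

lemma PropertyA.enoughInjectives [IsArtinianRing R]
    (hE : IsInjectiveEnvelope R (R ⧸ Ring.jacobson R) E) [Injective E] [(dualFP h).IsEquivalence]
    [(isFP C).IsClosedUnderKernels] [(isFP I.Quot).IsClosedUnderKernels] (hI : I.PropertyA) :
    EnoughInjectives (FPMod I.Quot) where
  presentation F := by
    -- `b` generates the dual of `π_* F`, and `g` is chosen to pull the universal element back to
    -- `b`. An element killed by `g` is then killed by every map to `E`, hence is zero.
    obtain ⟨⟨B⟩, b, -, -, hb, -, -⟩ := (isFP_iff _).1 (h _ (hI.isFP_πStar _ F.property))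
    obtain ⟨M, ⟨e⟩⟩ := hI.exists_dual_iso_quotRight (h := h) hE B
    obtain ⟨g, hg⟩ := exists_hom_of_dual_iso_quotRight (h := h) hI e F b
    refine ⟨{ J := M, injective := injective_of_dual_iso_quotRight (h := h) hI e, f := g,
              mono := ?_ }⟩
    refine (isFP I.Quot).ι.mono_of_mono_map ((mono_iff _).2 fun ⟨X⟩ => ?_)
    rw [injective_iff_map_eq_zero]
    intro x hx
    by_contra hx0
    obtain ⟨ξ, hξ⟩ := exists_dualEval_ne_zero hE (M := I.πStar.obj F.obj) (X := X) hx0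
    obtain ⟨f, rfl⟩ := hb (Opposite.op X) ξ
    apply hξ
    subst hg
    have h1 : (I.πStar.map g.hom).hom.app B ((I.πStar.obj F.obj).obj.map f.unop x) = 0 :=
      (hom_app_map (I.πStar.map g.hom) f.unop x).trans
        ((congrArg ((I.πStar.obj M.obj).obj.map f.unop) hx).trans (map_zero _))
    let ε : ((toModuleCat R).obj (I.πStar.obj M.obj)).obj B ⟶ E :=
      dualEval (e.inv.hom.app _ (quotRightId B))
    exact (congrArg ε h1).trans (map_zero ε.hom)

end CatIdeal

end Dual

open CategoryTheory.Abelian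

/-! ### Flatness of the modules `Hom(-, Y)` -/

section

variable {C : Type u} [Category.{u} C] [Preadditive C]

lemma isFP_corep [HasZeroObject C] (Y : C) : isFP Cᵒᵖ (corepFunctor.obj Y) := by
  rw [isFP_iff]
  refine ⟨op Y, (𝟙 Y : Y ⟶ Y), op 0, 0,
    fun X m => ⟨(show X.unop ⟶ Y from m).op, Category.comp_id (show X.unop ⟶ Y from m)⟩,
    (isZero_zero C).eq_of_src (Y := Y) _ _, fun X f hf => ⟨0, ?_⟩⟩
  have : f.unop = 0 := (Category.comp_id f.unop).symm.trans hf
  rw [comp_zero, ← f.op_unop, this, op_zero]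

/-- The dual `Hom_ℤ(Hom(-, Y), A)` is the cofree module. -/
def zdualCorep (A : AddCommGrpCat.{u}) (Y : C) :
    (zdual A).obj (op (corepFunctor.obj Y)) ≅ cofree Y A :=
  (ObjectProperty.fullyFaithfulι _).preimageIso (NatIso.ofComponents (fun X =>
    AddEquiv.toAddCommGrpIso
      { toFun := fun f => (show (corepFunctor.obj Y).obj.obj (op X) ⟶ A from f).hom
        invFun := fun f => AddCommGrpCat.ofHom f
        left_inv := fun _ => rfl
        right_inv := fun _ => rfl
        map_add' := fun _ _ => rfl }) fun _ => rfl)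

/-- The dual of `Hom(-, Y)` into an injective group `A` is `cofree Y A`, an injective module. -/
lemma isZero_tor_corep (Y : C) (M : CMod C) (i : ℕ) :
    IsZero ((Tor (i + 1) (corepFunctor.obj Y)).obj M) := by
  rw [isZero_tor_iff]
  intro A _
  have := Ext.subsingleton_of_injective.{u} M (cofree Y A) i
  exact subsingleton_ext_of_iso (i := i + 1) (Iso.refl M) (zdualCorep A Y).symm

end

/-! ### The individual implications -/

namespace CatIdeal

variable {C : Type u} [Category.{u} C] [Preadditive C] {I : CatIdeal C}

lemma IsKIdempotent.subsingleton_ext {k : ℕ} (h : I.IsKIdempotent k) (F J : CMod I.Quot)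
    [Injective J] (i : ℕ) (hi : 1 ≤ i) (hik : i ≤ k) :
    Subsingleton (Abelian.Ext.{u} (I.πStar.obj F) (I.πStar.obj J) i) := by
  obtain ⟨i, rfl⟩ := Nat.exists_eq_add_of_le' hi
  have := Ext.subsingleton_of_injective.{u} F J i
  exact (h (i + 1) hik F J).surjective.subsingleton

lemma isKIdempotent_of_isZero_TOR {k : ℕ} (h : ∀ i : ℕ, 1 ≤ i → i ≤ k → ∀ X : I.Quot,
    IsZero ((I.TOR i).obj (I.πStar.obj (rep X)))) : I.IsKIdempotent k := by
  rw [isKIdempotent_iff]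
  intro F X i hi hik
  refine I.subsingleton_ext_πStar_of_cofree k (fun Y A hA i hi hik => ?_) i hi hik F
  obtain ⟨i, rfl⟩ := Nat.exists_eq_add_of_le' hi
  exact (I.isZero_TOR_iff _ _).1 (h (i + 1) hi hik X) Y A hA

lemma IsKIdempotent.isZero_EXT {k : ℕ} (h : I.IsKIdempotent k) (i : ℕ) (hi : 1 ≤ i)
    (hik : i ≤ k) (F : CMod I.Quot) : IsZero ((I.EXT i).obj (I.πStar.obj F)) := by
  obtain ⟨i, rfl⟩ := Nat.exists_eq_add_of_le' hi
  exact (I.isZero_EXT_iff _ _).2 fun X => (I.isKIdempotent_iff k).1 h F X (i + 1) hi hik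

lemma IsKIdempotent.isIso_torComparison {k : ℕ} (h : I.IsKIdempotent k) (i : ℕ) (hi : 1 ≤ i)
    (hik : i ≤ k) (F : CMod I.Quotᵒᵖ) (F' : CMod I.Quot) : IsIso (I.torComparison F F' i) := by
  obtain ⟨i, rfl⟩ := Nat.exists_eq_add_of_le' hi
  exact CatIdeal.isIso_torComparison I F F' k
    (fun J hJ i hi hik => h.subsingleton_ext F' J i hi hik) i hik

/-- With `Hom(-, Y)` in the first argument the target of ψ vanishes, and the source is the Tor group
that tests TOR at `Y`. -/
lemma isZero_TOR_of_isIso_torComparison {F : CMod I.Quot} {i : ℕ}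
    (h : ∀ Y : I.Quot, IsIso (I.torComparison (corepFunctor.obj Y) F (i + 1))) :
    IsZero ((I.TOR (i + 1)).obj (I.πStar.obj F)) := by
  rw [isZero_TOR_iff_tor]
  intro Y
  exact (isZero_tor_corep Y F i).of_iso
    (@asIso _ _ _ _ (I.torComparison (corepFunctor.obj Y) F (i + 1)) (h Y))

variable {R : Type u} [CommRing R] [IsArtinianRing R] [Linear R C]
  [HasZeroObject C] [HasBinaryBiproducts C]

/-- Since `C(-, Y)/I(-, Y)` is the dual of some `π_* M`, its `ℤ`-dual is a double dual of `π_* M`.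
Ext-vanishing passes to double duals because property A makes `π_* rep X` finitely presented over
`C`. -/
lemma PropertyA.isZero_TOR_rep [(isFP C).IsClosedUnderKernels] (hI : I.PropertyA)
    {E : ModuleCat.{u} R} (hE : IsInjectiveEnvelope R (R ⧸ Ring.jacobson R) E) [Injective E]
    {h : ∀ M : CMod C, isFP C M → isFP Cᵒᵖ ((dualFunctor R E).obj (Opposite.op M))}
    [(dualFP h).EssSurj] {X : I.Quot} {i : ℕ}
    (H : ∀ F : FPMod I.Quot,
      Subsingleton (Abelian.Ext.{u} (I.πStar.obj (rep X)) (I.πStar.obj F.obj) (i + 1))) :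
    IsZero ((I.TOR (i + 1)).obj (I.πStar.obj (rep X))) := by
  rw [isZero_TOR_iff_tor]
  rintro ⟨Y⟩
  rw [isZero_tor_iff]
  intro A _
  obtain ⟨M, ⟨e⟩⟩ := hI.exists_dual_iso_quotRight (h := h) hE Y
  have := subsingleton_ext_zdual_dualFunctor E A
    ⟨I.πStar.obj (rep X), hI.isFP_πStar _ (isFP_rep X)⟩ (I.πStar.obj M.obj) i (H M)
  exact subsingleton_ext_of_iso (i := i + 1) (Iso.refl (I.πStar.obj (rep X)))
    ((zdual A).mapIso e.symm.op)

end CatIdeal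

end

end KIdem

/-! ### The equivalence of the seven conditions -/

theorem mainTheorem3 {R : Type u} [CommRing R] [IsArtinianRing R]
    {C : Type u} [Category.{u} C] [Preadditive C] [Linear R C]
    [HasZeroObject C] [HasBinaryBiproducts C] [IsIdempotentComplete C]
    (hC : KIdem.IsDualizing R C) (I : KIdem.CatIdeal C) (hI : I.PropertyA) (k : ℕ) :
    haveI : (KIdem.isFP C).IsClosedUnderKernels := hC.isClosedUnderKernels
    haveI : (KIdem.isFP I.Quot).IsClosedUnderKernels := hI.isClosedUnderKernels_quot
    List.TFAE [
      I.IsKIdempotent k,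
      ∀ i : ℕ, i ≤ k → ∀ F F' : KIdem.FPMod I.Quot,
        Function.Bijective (hI.πStarFP.mapExtAddHom F F' i),
      ∀ i : ℕ, 1 ≤ i → i ≤ k → ∀ F' : KIdem.CMod I.Quot, KIdem.isFP I.Quot F' →
        IsZero ((I.EXT i).obj (I.πStar.obj F')),
      ∀ i : ℕ, 1 ≤ i → i ≤ k → ∀ J : KIdem.FPMod I.Quot, Injective J →
        IsZero ((I.EXT i).obj (I.πStar.obj J.obj)),
      ∀ i : ℕ, 1 ≤ i → i ≤ k → ∀ (F : KIdem.CMod I.Quotᵒᵖ) (F' : KIdem.CMod I.Quot),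
        KIdem.isFP I.Quotᵒᵖ F → KIdem.isFP I.Quot F' → IsIso (I.torComparison F F' i),
      ∀ i : ℕ, 1 ≤ i → i ≤ k → ∀ F' : KIdem.CMod I.Quot, KIdem.isFP I.Quot F' →
        IsZero ((I.TOR i).obj (I.πStar.obj F')),
      ∀ i : ℕ, 1 ≤ i → i ≤ k → ∀ X : I.Quot,
        IsZero ((I.TOR i).obj (I.πStar.obj (KIdem.rep X)))] := by
  have : (KIdem.isFP C).IsClosedUnderKernels := hC.isClosedUnderKernels
  have : (KIdem.isFP I.Quot).IsClosedUnderKernels := hI.isClosedUnderKernels_quot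
  obtain ⟨-, E, hE, h, hD⟩ := hC
  have hD : (KIdem.dualFP h).IsEquivalence := hD
  have : Injective E := have := hE.1; Module.injective_object_of_injective_module R E
  have : EnoughInjectives (KIdem.FPMod I.Quot) := hI.enoughInjectives (h := h) hE
  tfae_have 1 → 3 := fun H i hi hik F' _ => H.isZero_EXT i hi hik F'
  tfae_have 2 ↔ 3 := by
    rw [hI.mapExt_πStarFP_bijective_iff k]
    constructor
    · intro H i hi hik F hF
      obtain ⟨i, rfl⟩ := Nat.exists_eq_add_of_le' hi
      exact (I.isZero_EXT_iff _ _).2 fun X => H ⟨F, hF⟩ X (i + 1) hi hik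
    · intro H F X i hi hik
      obtain ⟨i, rfl⟩ := Nat.exists_eq_add_of_le' hi
      exact (I.isZero_EXT_iff _ _).1 (H (i + 1) hi hik F.obj F.property) X
  tfae_have 3 → 4 := fun H i hi hik J _ => H i hi hik J.obj J.property
  -- Enough injectives in mod(C/I) extend the vanishing to all finitely presented `F`; passing to
  -- double duals then gives TOR.
  tfae_have 4 → 7 := by
    intro H i hi hik X
    obtain ⟨i, rfl⟩ := Nat.exists_eq_add_of_le' hi
    refine hI.isZero_TOR_rep (h := h) hE fun F => ?_
    refine KIdem.CatIdeal.subsingleton_ext_πStar_of_injective k (fun J hJ i hi hik => ?_)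
      (i + 1) hi hik F
    obtain ⟨i, rfl⟩ := Nat.exists_eq_add_of_le' hi
    exact (I.isZero_EXT_iff _ _).1 (H (i + 1) hi hik J hJ) X
  -- Here one leaves the finitely presented modules: vanishing against cofree modules reaches every
  -- `C/I`-module.
  tfae_have 7 → 1 := KIdem.CatIdeal.isKIdempotent_of_isZero_TOR
  tfae_have 1 → 5 := fun H i hi hik F F' _ _ => H.isIso_torComparison i hi hik F F'
  tfae_have 5 → 6 := by
    intro H i hi hik F hF
    obtain ⟨i, rfl⟩ := Nat.exists_eq_add_of_le' hi
    exact KIdem.CatIdeal.isZero_TOR_of_isIso_torComparison fun Y =>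
      H (i + 1) hi hik _ F (KIdem.isFP_corep Y) hF
  tfae_have 6 → 7 := fun H i hi hik X => H i hi hik _ (KIdem.isFP_rep X)
  tfae_finish
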